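/- Write $\mathbb{R}_+=(0,\infty)$, $w_m(x)=1+x^m$ and $X_{0,m}=L_1(\mathbb{R}_+,w_m(x)\,dx)$ (real-valued functions, with the natural norm and order). Let $a,a_1,r$ be measurable functions on $\mathbb{R}_+$ and $b$ a measurable function on $\mathbb{R}_+^2$ such that: (1) $0\le a\in L_{\infty,loc}([0,\infty))$ and $0\le a_1\in L_{\infty,loc}([0,\infty))$, and $a_1/a$ remains bounded as $x\to\infty$, that is, there is a constant $C$ with $a_1(x)\le C a(x)$ for almost all sufficiently large $x$; (2) $1/r\in L_{1,loc}(\mathbb{R}_+)$ and $0<r(x)\le r_0+r_1x$ on $\mathbb{R}_+$ for some constants $r_0,r_1\ge 0$; (3) $b\ge 0$, $b(x,y)=0$ for $x>y$, and $\int_0^y x\,b(x,y)\,dx=y$ for every $y>0$. For $p\ge 0$ let $n_p(y)=\int_0^y b(x,y)x^p\,dx$ and $N_p(y)=y^p-n_p(y)$. Assume further: (4) $n_0(y)\le b_0(1+y^l)$ for all $y>0$, for some constants $b_0>0$ and $l\ge 0$; (5) $\liminf_{y\to\infty} N_{m_0}(y)/y^{m_0}>0$ for some $m_0>1$ (equivalently,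 for every $m_0>1$); (6) $m>\max\{1,l\}$. Put $q=a+a_1$. Let $T_{0,m}f=-\frac{d}{dx}(rf)-qf$, with domain $D(T_{0,m})$ consisting of all $f\in X_{0,m}$ such that $rf$ is (a.e. equal to a function that is) absolutely continuous on every compact subinterval of $\mathbb{R}_+$, $\frac{d}{dx}(rf)\in X_{0,m}$, $qf\in X_{0,m}$ and, in the case where $1/r$ is integrable in a right neighbourhood of $0$, in addition $r(x)f(x)\to 0$ as $x\to 0^+$. Let $(B_{0,m}f)(x)=\int_x^\infty a(y)b(x,y)f(y)\,dy$, with domain $D(B_{0,m})$ consisting of all $f\in X_{0,m}$ for which this integral converges absolutely for almost every $x>0$ and defines an element of $X_{0,m}$. Then $D(T_{0,m})\subseteq D(B_{0,m})$, and the operator $G_{0,m}=T_{0,m}+B_{0,m}$ with domain $D(G_{0,m})=D(T_{0,m})$ is the infinitesimal generator of a strongly continuous semigroup $(S_{G_{0,m}}(t))_{t\ge 0}$ of bounded linear operators on $X_{0,m}$ that is positive, i.e. $S_{G_{0,m}}(t)f\ge 0$ for all $t\ge 0$ and all $f\in X_{0,m}$ with $f\ge 0$. -/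

import Mathlib

open MeasureTheory Set Filter Topology
open scoped ENNReal NNReal

noncomputable section

namespace GrowthFrag

/-- Lebesgue measure on `ℝ₊ = (0, ∞)`. -/
def halfLine : Measure ℝ := volume.restrict (Ioi 0)

/-- The measure `(1 + x ^ m) dx` on `(0, ∞)`. -/
def weightMeasure (m : ℝ) : Measure ℝ :=
  halfLine.withDensity fun x => ENNReal.ofReal (1 + x ^ m)

/-- The space `X_{0,m} = L₁(ℝ₊, (1 + x ^ m) dx)`, with its usual norm and order. -/
abbrev X (m : ℝ) : Type := Lp ℝ 1 (weightMeasure m)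

theorem ae_weightMeasure (m : ℝ) : ae (weightMeasure m) = ae halfLine := by
  apply le_antisymm
  · exact (withDensity_absolutelyContinuous _ _).ae_le
  · refine (withDensity_absolutelyContinuous' ?_ ?_).ae_le
    · exact (by fun_prop : Measurable fun x : ℝ => ENNReal.ofReal (1 + x ^ m)).aemeasurable
    · refine (ae_restrict_mem measurableSet_Ioi).mono fun x hx => ?_
      have : 0 < 1 + x ^ m := by
        have := Real.rpow_pos_of_pos (mem_Ioi.1 hx) m
        linarith
      simpa using this

/-- `g ∈ L_{∞,loc}([0, ∞))`. -/
def LocEssBounded (g : ℝ → ℝ) : Prop :=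
  AEMeasurable g halfLine ∧
    ∀ ρ : ℝ, ∃ M : ℝ, ∀ᵐ x ∂(volume.restrict (Ioc 0 ρ)), |g x| ≤ M

/-! ### Moments of the fragmentation kernel -/

/-- `n_m(y) = ∫₀^y b(x, y) x ^ m dx`, for nonnegative `b`, as a value in `[0, ∞]`. -/
def kernelMoment (b : ℝ → ℝ → ℝ) (m y : ℝ) : ℝ≥0∞ :=
  ∫⁻ x in Ioc 0 y, ENNReal.ofReal (b x y * x ^ m)

/-- `N_m(y) = y ^ m - n_m(y)`; used only for `m > 1`, where mass conservation makes
`n_m(y)` finite. -/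
def momentDefect (b : ℝ → ℝ → ℝ) (m y : ℝ) : ℝ :=
  y ^ m - (kernelMoment b m y).toReal

/-! ### The transport operator -/

/-- `F` is absolutely continuous on every compact subinterval of `(0, ∞)`. -/
def ACLoc (F : ℝ → ℝ) : Prop :=
  ∀ α β : ℝ, 0 < α → α ≤ β → AbsolutelyContinuousOnInterval F α β

theorem ACLoc.continuousOn {F : ℝ → ℝ} (hF : ACLoc F) : ContinuousOn F (Ioi 0) := by
  intro x hx
  have hx : 0 < x := hx
  have h := (hF (x / 2) (x + 1) (by linarith) (by linarith)).continuousOn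
  rw [uIcc_of_le (by linarith)] at h
  exact (h.continuousAt (Icc_mem_nhds (by linarith) (by linarith))).continuousWithinAt

theorem ACLoc.ae_differentiableAt {F : ℝ → ℝ} (hF : ACLoc F) :
    ∀ᵐ x ∂halfLine, DifferentiableAt ℝ F x := by
  rw [halfLine, ae_restrict_iff' measurableSet_Ioi]
  have h : ∀ n : ℕ, ∀ᵐ x : ℝ, x ∈ uIcc (1 / ((n : ℝ) + 1)) (n + 1) → DifferentiableAt ℝ F x := by
    intro n
    refine (hF _ _ (by positivity) ?_).ae_differentiableAt
    have h0 : (0 : ℝ) ≤ n := n.cast_nonneg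
    rw [div_le_iff₀ (by positivity)]
    nlinarith
  filter_upwards [ae_all_iff.2 h] with x hx hx0
  have hx0 : 0 < x := hx0
  obtain ⟨n, hn⟩ := exists_nat_gt (max x (1 / x))
  have h1 : x < n := lt_of_le_of_lt (le_max_left _ _) hn
  have h2 : 1 / x < n := lt_of_le_of_lt (le_max_right _ _) hn
  refine hx n (Icc_subset_uIcc ⟨?_, by linarith⟩)
  rw [div_le_iff₀ (by linarith)]
  rw [div_lt_iff₀ hx0] at h2
  nlinarith

theorem ACLoc.add {F G : ℝ → ℝ} (hF : ACLoc F) (hG : ACLoc G) : ACLoc (F + G) :=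
  fun α β h h' => (hF α β h h').add (hG α β h h')

theorem ACLoc.smul {F : ℝ → ℝ} (c : ℝ) (hF : ACLoc F) : ACLoc (c • F) :=
  fun α β h h' => (hF α β h h').const_smul c

/-- `f` belongs to the domain of the transport operator, and `F` is the locally absolutely
continuous representative of `r f`: `rf ∈ AC(ℝ₊)`, `(rf)' ∈ X_{0,m}`, `qf ∈ X_{0,m}` and, in the
case where `1 / r` is integrable near `0`, `r(x) f(x) → 0` as `x → 0⁺`. -/
structure IsTransportRep (m : ℝ) (r q : ℝ → ℝ) (f : X m) (F : ℝ → ℝ) : Prop where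
  ac : ACLoc F
  eq : F =ᵐ[halfLine] fun x => r x * f x
  memLp_deriv : MemLp (deriv F) 1 (weightMeasure m)
  memLp_mul : MemLp (fun x => q x * f x) 1 (weightMeasure m)
  boundary : IntegrableAtFilter (fun x => 1 / r x) (𝓝[>] 0) volume → Tendsto F (𝓝[>] 0) (𝓝 0)

theorem coeFn_add' {m : ℝ} (f g : X m) : ∀ᵐ x ∂halfLine, (f + g : X m) x = f x + g x := by
  rw [← ae_weightMeasure m]
  exact Lp.coeFn_add f g

theorem coeFn_smul' {m : ℝ} (c : ℝ) (f : X m) : ∀ᵐ x ∂halfLine, (c • f : X m) x = c * f x := by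
  rw [← ae_weightMeasure m]
  exact Lp.coeFn_smul c f

section transport

variable {m : ℝ} {r q : ℝ → ℝ} {f g : X m} {F G : ℝ → ℝ}

theorem IsTransportRep.deriv_eq (hF : IsTransportRep m r q f F) (hG : IsTransportRep m r q f G) :
    deriv F =ᵐ[halfLine] deriv G := by
  have h : EqOn F G (Ioi 0) :=
    Measure.eqOn_open_of_ae_eq (μ := volume) (hF.eq.trans hG.eq.symm) isOpen_Ioi
      hF.ac.continuousOn hG.ac.continuousOn
  refine (ae_restrict_mem measurableSet_Ioi).mono fun x hx => ?_
  exact (h.eventuallyEq_of_mem (Ioi_mem_nhds hx)).deriv_eq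

theorem ACLoc.deriv_add (hF : ACLoc F) (hG : ACLoc G) :
    deriv (F + G) =ᵐ[halfLine] deriv F + deriv G := by
  filter_upwards [hF.ae_differentiableAt, hG.ae_differentiableAt] with x h h'
  simpa using _root_.deriv_add h h'

theorem deriv_smul_fun (c : ℝ) (F : ℝ → ℝ) : deriv (c • F) = c • deriv F := by
  ext x
  simp [Pi.smul_def]

theorem IsTransportRep.add (hF : IsTransportRep m r q f F) (hG : IsTransportRep m r q g G) :
    IsTransportRep m r q (f + g) (F + G) where
  ac := hF.ac.add hG.ac
  eq := by
    filter_upwards [hF.eq, hG.eq, coeFn_add' f g] with x h1 h2 h3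
    simp only [Pi.add_apply, h1, h2, h3]
    ring
  memLp_deriv := by
    refine (memLp_congr_ae ?_).1 (hF.memLp_deriv.add hG.memLp_deriv)
    rw [EventuallyEq, ae_weightMeasure]
    exact (hF.ac.deriv_add hG.ac).symm
  memLp_mul := by
    refine (memLp_congr_ae ?_).1 (hF.memLp_mul.add hG.memLp_mul)
    rw [EventuallyEq, ae_weightMeasure]
    filter_upwards [coeFn_add' f g] with x h3
    simp only [Pi.add_apply, h3]
    ring
  boundary h := by
    have := (hF.boundary h).add (hG.boundary h)
    rwa [add_zero] at this

theorem IsTransportRep.smul (c : ℝ) (hF : IsTransportRep m r q f F) :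
    IsTransportRep m r q (c • f) (c • F) where
  ac := hF.ac.smul c
  eq := by
    filter_upwards [hF.eq, coeFn_smul' c f] with x h1 h3
    simp only [Pi.smul_apply, smul_eq_mul, h1, h3]
    ring
  memLp_deriv := by
    rw [deriv_smul_fun]
    exact hF.memLp_deriv.const_smul c
  memLp_mul := by
    refine (memLp_congr_ae ?_).1 (hF.memLp_mul.const_smul c)
    rw [EventuallyEq, ae_weightMeasure]
    filter_upwards [coeFn_smul' c f] with x h3
    simp only [Pi.smul_apply, smul_eq_mul, h3]
    ring
  boundary h := by
    have := (hF.boundary h).const_smul c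
    rwa [smul_zero] at this

theorem IsTransportRep.zero : IsTransportRep m r q 0 0 where
  ac := fun α β _ _ => by simpa [AbsolutelyContinuousOnInterval] using tendsto_const_nhds
  eq := by
    have : ∀ᵐ x ∂halfLine, (0 : X m) x = 0 := by
      rw [← ae_weightMeasure m]
      exact Lp.coeFn_zero ℝ 1 (weightMeasure m)
    filter_upwards [this] with x h
    rw [h, mul_zero, Pi.zero_apply]
  memLp_deriv := by
    have : deriv (0 : ℝ → ℝ) = 0 := by
      ext x
      simp
    rw [this]
    exact MemLp.zero
  memLp_mul := by
    refine (memLp_congr_ae ?_).1 (MemLp.zero (ε := ℝ))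
    filter_upwards [Lp.coeFn_zero ℝ 1 (weightMeasure m)] with x h
    rw [h, Pi.zero_apply, mul_zero]
  boundary _ := tendsto_const_nhds

/-- The function `-(rf)' - qf`, where `F` represents `rf`. -/
theorem IsTransportRep.memLp (hF : IsTransportRep m r q f F) :
    MemLp (fun x => -deriv F x - q x * f x) 1 (weightMeasure m) :=
  hF.memLp_deriv.neg.sub hF.memLp_mul

/-- The value `-(rf)' - qf` does not depend on the choice of the representative. -/
theorem IsTransportRep.toLp_eq (hF : IsTransportRep m r q f F) (hG : IsTransportRep m r q f G) :
    hF.memLp.toLp = hG.memLp.toLp := by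
  rw [MemLp.toLp_eq_toLp_iff, EventuallyEq, ae_weightMeasure]
  filter_upwards [hF.deriv_eq hG] with x h
  simp [h]

end transport

/-- The transport operator `T_{0,m} f = -(rf)' - qf` on its domain. -/
def transportOp (m : ℝ) (r q : ℝ → ℝ) : X m →ₗ.[ℝ] X m where
  domain :=
    { carrier := {f | ∃ F, IsTransportRep m r q f F}
      add_mem' := fun ⟨F, hF⟩ ⟨G, hG⟩ => ⟨F + G, hF.add hG⟩
      zero_mem' := ⟨0, IsTransportRep.zero⟩
      smul_mem' := fun c _ ⟨F, hF⟩ => ⟨c • F, hF.smul c⟩ }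
  toFun :=
    { toFun := fun f => f.2.choose_spec.memLp.toLp
      map_add' := fun f g => by
        have hF := f.2.choose_spec
        have hG := g.2.choose_spec
        refine ((f + g).2.choose_spec.toLp_eq (hF.add hG)).trans ?_
        rw [← MemLp.toLp_add, MemLp.toLp_eq_toLp_iff, EventuallyEq, ae_weightMeasure]
        filter_upwards [hF.ac.deriv_add hG.ac, coeFn_add' f.1 g.1] with x h1 h2
        have h2' : ((f + g).1 : X m) x = f.1 x + g.1 x := h2
        simp only [h1, h2', Pi.add_apply]
        ring
      map_smul' := fun c f => by
        have hF := f.2.choose_spec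
        refine ((c • f).2.choose_spec.toLp_eq (hF.smul c)).trans ?_
        rw [RingHom.id_apply, ← MemLp.toLp_const_smul, MemLp.toLp_eq_toLp_iff, EventuallyEq,
          ae_weightMeasure]
        filter_upwards [coeFn_smul' c f.1] with x h2
        have h2' : ((c • f).1 : X m) x = c * f.1 x := h2
        simp only [deriv_smul_fun, h2', Pi.smul_apply, smul_eq_mul]
        ring }

/-! ### The fragmentation gain operator -/

/-- `x ↦ ∫_x^∞ a(y) b(x, y) f(y) dy`. -/
def gain (a : ℝ → ℝ) (b : ℝ → ℝ → ℝ) (f : ℝ → ℝ) (x : ℝ) : ℝ :=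
  ∫ y in Ioi x, a y * b x y * f y

/-- `f` belongs to the domain of the gain operator: the integral defining it converges
absolutely for a.e. `x > 0` and its value is an element of `X_{0,m}`. -/
structure InGainDomain (m : ℝ) (a : ℝ → ℝ) (b : ℝ → ℝ → ℝ) (f : X m) : Prop where
  integrable : ∀ᵐ x ∂halfLine, IntegrableOn (fun y => a y * b x y * f y) (Ioi x)
  memLp : MemLp (gain a b f) 1 (weightMeasure m)

section gain

variable {m : ℝ} {a : ℝ → ℝ} {b : ℝ → ℝ → ℝ} {f g : X m}

theorem ae_Ioi_of_halfLine {p : ℝ → Prop} (h : ∀ᵐ y ∂halfLine, p y) {x : ℝ} (hx : 0 < x) :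
    ∀ᵐ y ∂(volume.restrict (Ioi x)), p y :=
  ae_restrict_of_ae_restrict_of_subset (Ioi_subset_Ioi hx.le) h

theorem integrand_add {x : ℝ} (hx : 0 < x) :
    (fun y => a y * b x y * (f + g : X m) y) =ᵐ[volume.restrict (Ioi x)]
      fun y => a y * b x y * f y + a y * b x y * g y := by
  filter_upwards [ae_Ioi_of_halfLine (coeFn_add' f g) hx] with y h
  rw [h]
  ring

theorem integrand_smul (c : ℝ) {x : ℝ} (hx : 0 < x) :
    (fun y => a y * b x y * (c • f : X m) y) =ᵐ[volume.restrict (Ioi x)]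
      fun y => c * (a y * b x y * f y) := by
  filter_upwards [ae_Ioi_of_halfLine (coeFn_smul' c f) hx] with y h
  rw [h]
  ring

theorem InGainDomain.gain_add (hf : InGainDomain m a b f) (hg : InGainDomain m a b g) :
    gain a b (f + g : X m) =ᵐ[weightMeasure m] gain a b f + gain a b g := by
  rw [EventuallyEq, ae_weightMeasure]
  filter_upwards [hf.integrable, hg.integrable, ae_restrict_mem measurableSet_Ioi] with x h1 h2 hx
  simp only [gain, Pi.add_apply]
  rw [integral_congr_ae (integrand_add hx), integral_add h1 h2]

theorem gain_smul (c : ℝ) (f : X m) :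
    gain a b (c • f : X m) =ᵐ[weightMeasure m] c • gain a b f := by
  rw [EventuallyEq, ae_weightMeasure]
  filter_upwards [ae_restrict_mem measurableSet_Ioi] with x hx
  simp only [gain, Pi.smul_apply, smul_eq_mul]
  rw [integral_congr_ae (integrand_smul c hx), integral_const_mul]

theorem InGainDomain.add (hf : InGainDomain m a b f) (hg : InGainDomain m a b g) :
    InGainDomain m a b (f + g) where
  integrable := by
    filter_upwards [hf.integrable, hg.integrable, ae_restrict_mem measurableSet_Ioi]
      with x h1 h2 hx
    exact (h1.add h2).congr (integrand_add hx).symm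
  memLp := (memLp_congr_ae (hf.gain_add hg)).2 (hf.memLp.add hg.memLp)

theorem InGainDomain.smul (c : ℝ) (hf : InGainDomain m a b f) : InGainDomain m a b (c • f) where
  integrable := by
    filter_upwards [hf.integrable, ae_restrict_mem measurableSet_Ioi] with x h1 hx
    exact (Integrable.const_mul h1 c).congr (integrand_smul c hx).symm
  memLp := (memLp_congr_ae (gain_smul c f)).2 (hf.memLp.const_smul c)

theorem InGainDomain.zero : InGainDomain m a b 0 := by
  have h0 : ∀ᵐ y ∂halfLine, (0 : X m) y = 0 := by
    rw [← ae_weightMeasure m]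
    exact Lp.coeFn_zero ℝ 1 (weightMeasure m)
  have h1 : ∀ x : ℝ, 0 < x → (fun y => a y * b x y * (0 : X m) y)
      =ᵐ[volume.restrict (Ioi x)] fun _ => 0 := fun x hx => by
    filter_upwards [ae_Ioi_of_halfLine h0 hx] with y h
    rw [h, mul_zero]
  refine ⟨?_, (memLp_congr_ae ?_).1 (MemLp.zero (ε := ℝ))⟩
  · filter_upwards [ae_restrict_mem measurableSet_Ioi] with x hx
    exact (integrable_zero _ _ _).congr (h1 x hx).symm
  · rw [EventuallyEq, ae_weightMeasure]
    filter_upwards [ae_restrict_mem measurableSet_Ioi] with x hx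
    rw [gain, integral_congr_ae (h1 x hx), integral_zero, Pi.zero_apply]

end gain

/-- The gain operator `(B_{0,m} f)(x) = ∫_x^∞ a(y) b(x, y) f(y) dy` on its maximal domain. -/
def gainOp (m : ℝ) (a : ℝ → ℝ) (b : ℝ → ℝ → ℝ) : X m →ₗ.[ℝ] X m where
  domain :=
    { carrier := {f | InGainDomain m a b f}
      add_mem' := fun hf hg => InGainDomain.add hf hg
      zero_mem' := InGainDomain.zero
      smul_mem' := fun c _ hf => InGainDomain.smul c hf }
  toFun :=
    { toFun := fun f => f.2.memLp.toLp
      map_add' := fun f g => by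
        rw [← MemLp.toLp_add, MemLp.toLp_eq_toLp_iff]
        exact InGainDomain.gain_add f.2 g.2
      map_smul' := fun c f => by
        rw [RingHom.id_apply, ← MemLp.toLp_const_smul, MemLp.toLp_eq_toLp_iff]
        exact gain_smul c f.1 }

/-! ### Strongly continuous semigroups -/

/-- A strongly continuous semigroup (`C₀`-semigroup) of bounded operators on `E`. -/
structure C0Semigroup (E : Type*) [NormedAddCommGroup E] [NormedSpace ℝ E] where
  S : ℝ≥0 → E →L[ℝ] E
  map_zero : S 0 = ContinuousLinearMap.id ℝ E
  map_add : ∀ s t, S (s + t) = (S s).comp (S t)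
  strongly_continuous : ∀ f : E, Continuous fun t => S t f

/-- `A` is the infinitesimal generator of the semigroup: `f ∈ D(A)` with `A f = g` exactly when
`(S(t) f - f) / t → g` as `t → 0⁺`. -/
def C0Semigroup.IsGenerator {E : Type*} [NormedAddCommGroup E] [NormedSpace ℝ E]
    (𝒮 : C0Semigroup E) (A : E →ₗ.[ℝ] E) : Prop :=
  ∀ f g : E, (f, g) ∈ A.graph ↔
    Tendsto (fun t : ℝ≥0 => (t : ℝ)⁻¹ • (𝒮.S t f - f)) (𝓝[>] 0) (𝓝 g)

/-- The semigroup maps the positive cone of `X_{0,m}` into itself. -/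
def C0Semigroup.IsPositive {m : ℝ} (𝒮 : C0Semigroup (X m)) : Prop :=
  ∀ t, ∀ f : X m, 0 ≤ f → 0 ≤ 𝒮.S t f

end GrowthFrag

end

open GrowthFrag

/-! ### Exponentials of bounded operators and the Hille–Yosida theorem. -/

namespace HilleYosida

variable {E : Type*} [NormedAddCommGroup E] [NormedSpace ℝ E]

/-! Write `w(x) = 1 + x^m`, and call `∫ w f` the mass of `f`. Two estimates on nonnegative `f` in
the domain of `T` carry the theorem. Integrating `-(rf)' - qf` against `w` by parts bounds the mass
of `T f` by `K ∫ w f - ∫ w q f` with `K = m (r₀ + r₁)`, since the linear bound on `r` gives `r w' ≤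
K w` (`massL_transportOp_le`). By Tonelli, the mass of `B f` is at most the integral of `a(y) f(y)`
against `∫₀^y b(x, y) w(x) dx`. Because of the moment defect and `l < m`, this inner integral is at
most `η w(y)` for large `y`, with some `η < 1` (`exists_kernelWeight_bounds`); on the remaining
bounded range `a` is bounded. As `q ≥ a`, the loss term compensates the gain even after
amplification by `η⁻¹`: the mass of `T f + η⁻¹ B f` is at most a constant times the mass of `f`
(`massL_transportOp_add_gainOp_le`).

This margin makes the perturbation argument direct, with no closure to be taken. The equation `s f -
T f = g` is solved explicitly by an integrating factor, and positive data give positive solutions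
(`exists_solution`, `injective`). For large `s`, `B (s - T)⁻¹` is then a positive operator, and on
`L¹` such an operator is controlled by its action on the positive cone, so its norm is at most `η <
1`. The Neumann series inverts `s - T - B` on exactly the domain of `T`; the inverse is positive and
the mass balance bounds it by `(s - ω)⁻¹` (`exists_resolvent_of_positive_perturbation`).

With density of the domain (`dense_domain`), the Hille–Yosida theorem (`exists_semigroup`) yields
the semigroup. The exponentials of the Yosida approximations are, up to a positive scalar, power
series with nonnegative coefficients in the resolvent, so they preserve the positive cone, and so
does their limit. -/

theorem norm_exp_le [CompleteSpace E] (P : E →L[ℝ] E) : ‖NormedSpace.exp P‖ ≤ Real.exp ‖P‖ := by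
  have h := NormedSpace.exp_series_hasSum_exp' (𝕂 := ℝ) P
  have h' := NormedSpace.exp_series_hasSum_exp' (𝕂 := ℝ) ‖P‖
  rw [← Real.exp_eq_exp_ℝ] at h'
  refine h.norm_le_of_bounded h' fun n => ?_
  rw [norm_smul, Real.norm_of_nonneg (by positivity), smul_eq_mul]
  gcongr
  induction n with
  | zero =>
    rw [pow_zero, pow_zero]
    -- Only `≤ 1` is available for the norm of the identity, since `E` may be trivial.
    exact ContinuousLinearMap.norm_id_le (𝕜 := ℝ) (E := E)
  | succ n ih =>
    rw [pow_succ, pow_succ]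
    exact (norm_mul_le _ _).trans (by gcongr)

theorem exp_add_of_commute [CompleteSpace E] {P Q : E →L[ℝ] E} (h : Commute P Q) :
    NormedSpace.exp (P + Q) = NormedSpace.exp P * NormedSpace.exp Q :=
  letI := NormedAlgebra.restrictScalars ℚ ℝ (E →L[ℝ] E)
  NormedSpace.exp_add_of_commute h

/-- The exponential of `t (c² R - c)`, for a scalar `c` and a bounded operator `R`. -/
theorem exp_yosida_eq [CompleteSpace E] (R : E →L[ℝ] E) (c t : ℝ) :
    NormedSpace.exp (t • (c ^ 2 • R - c • (1 : E →L[ℝ] E))) =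
      Real.exp (-(t * c)) • NormedSpace.exp ((t * c ^ 2) • R) := by
  have e : t • (c ^ 2 • R - c • (1 : E →L[ℝ] E)) =
      (t * c ^ 2) • R + algebraMap ℝ (E →L[ℝ] E) (-(t * c)) := by
    rw [Algebra.algebraMap_eq_smul_one]
    module
  rw [e, exp_add_of_commute (Algebra.commute_algebraMap_right _ _),
    ← NormedSpace.algebraMap_exp_comm, ← Real.exp_eq_exp_ℝ, Algebra.algebraMap_eq_smul_one]
  simp

/-- The scalar factor `exp (-t c)` exactly absorbs the growth `exp (t c)` permitted by `‖c² R‖ ≤ c`.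
-/
theorem norm_exp_yosida_le [CompleteSpace E] {R : E →L[ℝ] E} {c t : ℝ} (hc : 0 < c) (ht : 0 ≤ t)
    (hR : ‖R‖ ≤ c⁻¹) :
    ‖NormedSpace.exp (t • (c ^ 2 • R - c • (1 : E →L[ℝ] E)))‖ ≤ 1 := by
  rw [exp_yosida_eq, norm_smul, Real.norm_of_nonneg (Real.exp_nonneg _)]
  have h1 : ‖(t * c ^ 2) • R‖ ≤ t * c := by
    rw [norm_smul, Real.norm_of_nonneg (by positivity)]
    calc t * c ^ 2 * ‖R‖ ≤ t * c ^ 2 * c⁻¹ := by gcongr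
      _ = t * c := by field_simp
  calc _ ≤ Real.exp (-(t * c)) * Real.exp (t * c) := by
        gcongr
        exact (norm_exp_le _).trans (Real.exp_le_exp.2 h1)
    _ = 1 := by rw [← Real.exp_add]; simp

/-- A closed convex cone that is invariant under `R` is invariant under `exp (t (c² R - c))`. -/
theorem exp_yosida_mem [CompleteSpace E] {K : Set E} (hK : IsClosed K) (hK0 : (0 : E) ∈ K)
    (hKadd : ∀ f ∈ K, ∀ g ∈ K, f + g ∈ K) (hKsmul : ∀ c : ℝ, 0 ≤ c → ∀ f ∈ K, c • f ∈ K)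
    {R : E →L[ℝ] E} (hR : ∀ f ∈ K, R f ∈ K) {c t : ℝ} (ht : 0 ≤ t) {f : E} (hf : f ∈ K) :
    NormedSpace.exp (t • (c ^ 2 • R - c • (1 : E →L[ℝ] E))) f ∈ K := by
  rw [exp_yosida_eq]
  refine hKsmul _ (Real.exp_nonneg _) _ ?_
  have h := (NormedSpace.exp_series_hasSum_exp' (𝕂 := ℝ) ((t * c ^ 2) • R)).mapL
    (ContinuousLinearMap.apply ℝ E f)
  refine hK.mem_of_tendsto h (Eventually.of_forall fun s => ?_)
  induction s using Finset.cons_induction with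
  | empty => simpa using hK0
  | cons n s hn ih =>
    rw [Finset.sum_cons]
    refine hKadd _ ?_ _ ih
    rw [smul_pow]
    refine hKsmul _ (by positivity) _ (hKsmul _ (by positivity) _ ?_)
    clear ih hn
    induction n with
    | zero => simpa using hf
    | succ n ih =>
      rw [pow_succ']
      exact hR _ ih

/-- If commuting bounded operators `P` and `Q` generate contraction semigroups, then these differ
by at most `t ‖P f - Q f‖` at `f`. -/
theorem norm_exp_sub_exp_le [CompleteSpace E] {P Q : E →L[ℝ] E} (hPQ : Commute P Q)
    (hP : ∀ t : ℝ, 0 ≤ t → ‖NormedSpace.exp (t • P)‖ ≤ 1)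
    (hQ : ∀ t : ℝ, 0 ≤ t → ‖NormedSpace.exp (t • Q)‖ ≤ 1) {t : ℝ} (ht : 0 ≤ t) (f : E) :
    ‖NormedSpace.exp (t • P) f - NormedSpace.exp (t • Q) f‖ ≤ t * ‖P f - Q f‖ := by
  -- The path joins `exp (tQ) f` at `s = 0` to `exp (tP) f` at `s = t`. Written as `exp (sP) exp ((t
  -- - s)Q) f`, it is a product of contractions, so its derivative is bounded by `‖(P - Q) f‖`.
  let h : ℝ → E := fun s => NormedSpace.exp (t • Q) (NormedSpace.exp (s • (P - Q)) f)
  have hc : Commute (P - Q) Q := hPQ.sub_left (Commute.refl Q)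
  have e : ∀ s, NormedSpace.exp (t • Q) * NormedSpace.exp (s • (P - Q)) =
      NormedSpace.exp (s • P) * NormedSpace.exp ((t - s) • Q) := fun s => by
    rw [← exp_add_of_commute, ← exp_add_of_commute]
    · congr 1
      module
    · exact (hPQ.smul_left _).smul_right _
    · exact (hc.symm.smul_left _).smul_right _
  have hd : ∀ s : ℝ, HasDerivAt h
      (NormedSpace.exp (t • Q) (NormedSpace.exp (s • (P - Q)) ((P - Q) f))) s := fun s => by
    have h1 := hasDerivAt_exp_smul_const (𝕂 := ℝ) (P - Q) s
    have h2 := ((NormedSpace.exp (t • Q)).comp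
      (ContinuousLinearMap.apply ℝ E f)).hasFDerivAt.comp_hasDerivAt s h1
    exact h2
  have hb : ∀ s ∈ Ico 0 t,
      ‖NormedSpace.exp (t • Q) (NormedSpace.exp (s • (P - Q)) ((P - Q) f))‖ ≤ ‖P f - Q f‖ := by
    intro s hs
    have := congrArg (fun T : E →L[ℝ] E => T ((P - Q) f)) (e s)
    refine (congrArg norm this).trans_le ?_
    calc _ ≤ 1 * ‖NormedSpace.exp ((t - s) • Q) ((P - Q) f)‖ :=
          ContinuousLinearMap.le_of_opNorm_le _ (hP s hs.1) _
      _ ≤ 1 * (1 * ‖(P - Q) f‖) := by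
          gcongr
          exact ContinuousLinearMap.le_of_opNorm_le _ (hQ _ (by linarith [hs.2])) _
      _ = _ := by simp
  have := norm_image_sub_le_of_norm_deriv_le_segment' (f := h) (a := 0) (b := t)
    (fun s _ => (hd s).hasDerivWithinAt) hb t (right_mem_Icc.2 ht)
  have e1 : h t = NormedSpace.exp (t • P) f := by
    have := congrArg (fun T : E →L[ℝ] E => T f) (e t)
    simpa [h] using this
  have e0 : h 0 = NormedSpace.exp (t • Q) f := by simp [h]
  rw [e1, e0, sub_zero] at this
  linarith

/-- `R` is the resolvent on `(ω, ∞)` of the operator with graph `Γ`, and satisfies the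
Hille–Yosida estimate for quasi-contractive semigroups. -/
structure IsResolvent (Γ : Set (E × E)) (ω : ℝ) (R : ℝ → E →L[ℝ] E) : Prop where
  mem_graph : ∀ s, ω < s → ∀ g, (R s g, s • R s g - g) ∈ Γ
  left_inv : ∀ s, ω < s → ∀ f g, (f, g) ∈ Γ → R s (s • f - g) = f
  norm_le : ∀ s, ω < s → ‖R s‖ ≤ (s - ω)⁻¹

namespace IsResolvent

variable {Γ : Set (E × E)} {ω : ℝ} {R : ℝ → E →L[ℝ] E}

/-- Subtracting `ω` from the operator reduces the quasi-contractive case to the contractive one. -/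
theorem shift (h : IsResolvent Γ ω R) :
    IsResolvent {p : E × E | (p.1, p.2 + ω • p.1) ∈ Γ} 0 fun s => R (s + ω) where
  mem_graph s hs g := by
    have := h.mem_graph (s + ω) (by linarith) g
    have e : s • R (s + ω) g - g + ω • R (s + ω) g = (s + ω) • R (s + ω) g - g := by module
    simpa [e] using this
  left_inv s hs f g hfg := by
    have := h.left_inv (s + ω) (by linarith) _ _ hfg
    have e : s • f - g = (s + ω) • f - (g + ω • f) := by module
    simpa [e] using this
  norm_le s hs := by simpa using h.norm_le (s + ω) (by linarith)

/-- The resolvent identity, used in both orders, shows that `s - t` annihilates the commutator. -/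
theorem commute (h : IsResolvent Γ ω R) {s t : ℝ} (hs : ω < s) (ht : ω < t) :
    Commute (R s) (R t) := by
  have key : ∀ s t, ω < s → ω < t → ∀ g, (s - t) • R s (R t g) = R t g - R s g := by
    intro s t hs ht g
    have := h.left_inv s hs _ _ (h.mem_graph t ht g)
    have e : s • R t g - (t • R t g - g) = (s - t) • R t g + g := by module
    rw [e, map_add, map_smul] at this
    exact eq_sub_of_add_eq this
  rcases eq_or_ne s t with rfl | hst
  · exact Commute.refl _
  · ext g
    have h1 := key s t hs ht g
    have h2 := key t s ht hs g
    have : (s - t) • (R s (R t g) - R t (R s g)) = 0 := by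
      rw [smul_sub, h1, ← neg_sub t s, neg_smul, h2]
      abel
    exact sub_eq_zero.1 ((smul_eq_zero.1 this).resolve_left (sub_ne_zero.2 hst))

/-- The Yosida approximations, for a contractive resolvent. -/
def yosida (R : ℝ → E →L[ℝ] E) (n : ℕ) : E →L[ℝ] E :=
  ((n : ℝ) + 1) ^ 2 • R (n + 1) - ((n : ℝ) + 1) • (1 : E →L[ℝ] E)

theorem norm_exp_yosida [CompleteSpace E] (h : IsResolvent Γ 0 R) (n : ℕ) {t : ℝ} (ht : 0 ≤ t) :
    ‖NormedSpace.exp (t • yosida R n)‖ ≤ 1 :=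
  norm_exp_yosida_le (by positivity) ht (by simpa using h.norm_le (n + 1) (by positivity))

theorem commute_yosida (h : IsResolvent Γ 0 R) (n : ℕ) {s : ℝ} (hs : 0 < s) :
    Commute (R s) (yosida R n) :=
  ((h.commute hs (by positivity)).smul_right _).sub_right ((Commute.one_right _).smul_right _)

theorem yosida_commute (h : IsResolvent Γ 0 R) (n k : ℕ) :
    Commute (yosida R n) (yosida R k) :=
  ((h.commute_yosida k (by positivity)).smul_left _).sub_left ((Commute.one_left _).smul_left _)

theorem yosida_apply (h : IsResolvent Γ 0 R) (n : ℕ) {f g : E} (hfg : (f, g) ∈ Γ) :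
    yosida R n f = ((n : ℝ) + 1) • R (n + 1) g := by
  have := h.left_inv (n + 1) (by positivity) f g hfg
  rw [map_sub, map_smul] at this
  have e : ((n : ℝ) + 1) • R (n + 1) f = f + R (n + 1) g := by
    rw [← sub_eq_iff_eq_add]
    exact this
  simp only [yosida, sub_apply, smul_apply, one_apply_eq_self]
  rw [pow_two, mul_smul, e]
  module

/-- On the domain the error is `R (n + 1) g`, of size `O(1 / n)`; density and the uniform bound `‖(n
+ 1) R (n + 1)‖ ≤ 1` give the general case. -/
theorem tendsto_smul_resolvent (h : IsResolvent Γ 0 R)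
    (hd : Dense {f : E | ∃ g, (f, g) ∈ Γ}) (f : E) :
    Tendsto (fun n : ℕ => ((n : ℝ) + 1) • R (n + 1) f) atTop (𝓝 f) := by
  have hb : ∀ (n : ℕ) (f : E), ‖((n : ℝ) + 1) • R (n + 1) f‖ ≤ ‖f‖ := by
    intro n f
    have h1 : ‖R (n + 1)‖ ≤ ((n : ℝ) + 1)⁻¹ := by simpa using h.norm_le (n + 1) (by positivity)
    rw [norm_smul, Real.norm_of_nonneg (by positivity)]
    calc _ ≤ ((n : ℝ) + 1) * (((n : ℝ) + 1)⁻¹ * ‖f‖) := by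
          gcongr
          exact ContinuousLinearMap.le_of_opNorm_le _ h1 _
      _ = _ := by field_simp
  have hc : ∀ f g, (f, g) ∈ Γ →
      Tendsto (fun n : ℕ => ((n : ℝ) + 1) • R (n + 1) f) atTop (𝓝 f) := by
    intro f g hfg
    rw [tendsto_iff_norm_sub_tendsto_zero]
    have h0 : Tendsto (fun n : ℕ => ((n : ℝ) + 1)⁻¹ * ‖g‖) atTop (𝓝 0) := by
      simpa using (tendsto_one_div_add_atTop_nhds_zero_nat (𝕜 := ℝ)).mul_const ‖g‖
    refine squeeze_zero (fun _ => norm_nonneg _) (fun n => ?_) h0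
    have := h.left_inv (n + 1) (by positivity) f g hfg
    rw [map_sub, map_smul] at this
    have e : ((n : ℝ) + 1) • R (n + 1) f - f = R (n + 1) g := sub_eq_of_eq_add' (by
      rw [← sub_eq_iff_eq_add]
      exact this)
    rw [e]
    have h1 : ‖R (n + 1)‖ ≤ ((n : ℝ) + 1)⁻¹ := by simpa using h.norm_le (n + 1) (by positivity)
    exact ContinuousLinearMap.le_of_opNorm_le _ h1 _
  rw [Metric.tendsto_atTop]
  intro ε hε
  obtain ⟨f', hf', g, hg⟩ := Metric.dense_iff.1 hd f (ε / 3) (by positivity)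
  obtain ⟨N, hN⟩ := Metric.tendsto_atTop.1 (hc f' g hg) (ε / 3) (by positivity)
  refine ⟨N, fun n hn => ?_⟩
  have h1 := hN n hn
  rw [Metric.mem_ball] at hf'
  have h2 : dist (((n : ℝ) + 1) • R (n + 1) f) (((n : ℝ) + 1) • R (n + 1) f') ≤ dist f' f := by
    rw [dist_eq_norm, ← smul_sub, ← map_sub, dist_comm, dist_eq_norm]
    exact hb n _
  have := dist_triangle4 (((n : ℝ) + 1) • R (n + 1) f) (((n : ℝ) + 1) • R (n + 1) f') f' f
  linarith

theorem tendsto_yosida (h : IsResolvent Γ 0 R)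
    (hd : Dense {f : E | ∃ g, (f, g) ∈ Γ}) {f g : E} (hfg : (f, g) ∈ Γ) :
    Tendsto (fun n => yosida R n f) atTop (𝓝 g) := by
  simp_rw [h.yosida_apply _ hfg]
  exact h.tendsto_smul_resolvent hd g

/-- On the domain, two approximating semigroups differ by at most `t` times the difference of their
generators, and these converge; contractivity extends this to all `f`. -/
theorem cauchySeq_exp_yosida [CompleteSpace E] (h : IsResolvent Γ 0 R)
    (hd : Dense {f : E | ∃ g, (f, g) ∈ Γ}) {t : ℝ} (ht : 0 ≤ t) (f : E) :
    CauchySeq fun n => NormedSpace.exp (t • yosida R n) f := by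
  have hb : ∀ (n : ℕ) (f : E), ‖NormedSpace.exp (t • yosida R n) f‖ ≤ ‖f‖ := fun n f => by
    simpa using ContinuousLinearMap.le_of_opNorm_le _ (h.norm_exp_yosida n ht) f
  rw [Metric.cauchySeq_iff]
  intro ε hε
  obtain ⟨f', hf', g, hg⟩ := Metric.dense_iff.1 hd f (ε / 3) (by positivity)
  rw [Metric.mem_ball] at hf'
  obtain ⟨N, hN⟩ := Metric.cauchySeq_iff.1 (h.tendsto_yosida hd hg).cauchySeq
    -- The divisor `t + 1`, rather than `t`, covers `t = 0`.
    (ε / (3 * (t + 1))) (by positivity)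
  refine ⟨N, fun k hk n hn => ?_⟩
  have h1 : dist (NormedSpace.exp (t • yosida R k) f') (NormedSpace.exp (t • yosida R n) f') <
      ε / 3 := by
    rw [dist_eq_norm]
    have h2 := hN k hk n hn
    rw [dist_eq_norm] at h2
    refine (norm_exp_sub_exp_le (h.yosida_commute k n) (fun s hs => h.norm_exp_yosida k hs)
      (fun s hs => h.norm_exp_yosida n hs) ht f').trans_lt ?_
    calc t * ‖yosida R k f' - yosida R n f'‖
        ≤ (t + 1) * ‖yosida R k f' - yosida R n f'‖ := by gcongr; linarith
      _ < (t + 1) * (ε / (3 * (t + 1))) := by gcongr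
      _ = ε / 3 := by field_simp
  have h3 : ∀ n, dist (NormedSpace.exp (t • yosida R n) f)
      (NormedSpace.exp (t • yosida R n) f') ≤ dist f' f := by
    intro n
    rw [dist_eq_norm, ← map_sub, dist_comm, dist_eq_norm]
    exact hb n _
  have h4 := h3 n
  rw [dist_comm] at h4
  have := dist_triangle4 (NormedSpace.exp (t • yosida R k) f)
    (NormedSpace.exp (t • yosida R k) f') (NormedSpace.exp (t • yosida R n) f')
    (NormedSpace.exp (t • yosida R n) f)
  linarith [h3 k]

/-- **Hille–Yosida theorem** for contraction semigroups; closed convex cones that are invariant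
under the resolvent are invariant under the semigroup. -/
theorem exists_contractionSemigroup [CompleteSpace E] (h : IsResolvent Γ 0 R)
    (hd : Dense {f : E | ∃ g, (f, g) ∈ Γ}) :
    ∃ 𝒮 : C0Semigroup E,
      (∀ f g : E, (f, g) ∈ Γ ↔
        Tendsto (fun t : ℝ≥0 => (t : ℝ)⁻¹ • (𝒮.S t f - f)) (𝓝[>] 0) (𝓝 g)) ∧
      ∀ K : Set E, IsClosed K → (0 : E) ∈ K → (∀ f ∈ K, ∀ g ∈ K, f + g ∈ K) →
        (∀ c : ℝ, 0 ≤ c → ∀ f ∈ K, c • f ∈ K) → (∀ s, 0 < s → ∀ f ∈ K, R s f ∈ K) →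
        ∀ t, ∀ f ∈ K, 𝒮.S t f ∈ K := by
  have hex : ∀ (t : ℝ≥0) (f : E), ∃ g,
      Tendsto (fun n => NormedSpace.exp ((t : ℝ) • yosida R n) f) atTop (𝓝 g) := fun t f =>
    cauchySeq_tendsto_of_complete (h.cauchySeq_exp_yosida hd t.2 f)
  choose V hV using hex
  let S : ℝ≥0 → E →L[ℝ] E := fun t =>
    continuousLinearMapOfTendsto (fun n => NormedSpace.exp ((t : ℝ) • yosida R n))
      (tendsto_pi_nhds.2 (hV t))
  have hS : ∀ (t : ℝ≥0) f, Tendsto (fun n => NormedSpace.exp ((t : ℝ) • yosida R n) f) atTop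
      (𝓝 (S t f)) := hV
  have hSb : ∀ t f, ‖S t f‖ ≤ ‖f‖ := fun t f => by
    refine le_of_tendsto (hS t f).norm (Eventually.of_forall fun n => ?_)
    simpa using ContinuousLinearMap.le_of_opNorm_le _ (h.norm_exp_yosida n t.2) f
  have h0 : S 0 = ContinuousLinearMap.id ℝ E := by
    ext f
    refine tendsto_nhds_unique (hS 0 f) ?_
    simp
  have hadd : ∀ s t, S (s + t) = (S s).comp (S t) := by
    intro s t
    ext f
    have e : ∀ n, NormedSpace.exp (((s + t : ℝ≥0) : ℝ) • yosida R n) f =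
        NormedSpace.exp ((s : ℝ) • yosida R n)
          (NormedSpace.exp ((t : ℝ) • yosida R n) f) := by
      intro n
      rw [NNReal.coe_add, add_smul, exp_add_of_commute
        (((Commute.refl _).smul_left _).smul_right _)]
      rfl
    refine tendsto_nhds_unique (hS (s + t) f) ?_
    simp_rw [e]
    rw [tendsto_iff_norm_sub_tendsto_zero]
    have h1 := tendsto_iff_norm_sub_tendsto_zero.1 (hS t f)
    have h2 := tendsto_iff_norm_sub_tendsto_zero.1 (hS s (S t f))
    refine squeeze_zero (fun _ => norm_nonneg _) (fun n => ?_) (by simpa using h1.add h2)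
    rw [ContinuousLinearMap.comp_apply]
    set Q := NormedSpace.exp ((s : ℝ) • yosida R n)
    set z := NormedSpace.exp ((t : ℝ) • yosida R n) f
    have e2 : Q z - S s (S t f) = Q (z - S t f) + (Q (S t f) - S s (S t f)) := by
      rw [map_sub]
      abel
    rw [e2]
    refine (norm_add_le _ _).trans ?_
    gcongr
    simpa using ContinuousLinearMap.le_of_opNorm_le _ (h.norm_exp_yosida n s.2) (z - S t f)
  -- distance between the semigroup and its approximations on the domain
  have hdist : ∀ {f g : E}, (f, g) ∈ Γ → ∀ (t : ℝ≥0) (n : ℕ),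
      ‖S t f - NormedSpace.exp ((t : ℝ) • yosida R n) f‖ ≤ t * ‖g - yosida R n f‖ := by
    intro f g hfg t n
    refine le_of_tendsto_of_tendsto ((hS t f).sub_const _).norm
      (((h.tendsto_yosida hd hfg).sub_const _).norm.const_mul (t : ℝ))
      (Eventually.of_forall fun k => ?_)
    exact norm_exp_sub_exp_le (h.yosida_commute k n) (fun s hs => h.norm_exp_yosida k hs)
      (fun s hs => h.norm_exp_yosida n hs) t.2 f
  -- Comparison of the approximating semigroup with the trivial one, generated by `0`.
  have hinc : ∀ {f g : E}, (f, g) ∈ Γ → ∀ t : ℝ≥0, ‖S t f - f‖ ≤ t * ‖g‖ := by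
    intro f g hfg t
    refine le_of_tendsto_of_tendsto ((hS t f).sub_const _).norm
      ((h.tendsto_yosida hd hfg).norm.const_mul (t : ℝ)) (Eventually.of_forall fun k => ?_)
    simpa using norm_exp_sub_exp_le (Commute.zero_right (yosida R k))
      (fun s hs => h.norm_exp_yosida k hs)
      (fun s _ => by
        rw [smul_zero, NormedSpace.exp_zero]
        exact ContinuousLinearMap.norm_id_le (𝕜 := ℝ) (E := E)) t.2 f
  -- By contractivity and the semigroup law, increments at any time are bounded by increments at
  -- time zero.
  have hlip : ∀ {f g : E}, (f, g) ∈ Γ → LipschitzWith ‖g‖₊ fun t => S t f := by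
    intro f g hfg
    have key : ∀ s t : ℝ≥0, s ≤ t → dist (S s f) (S t f) ≤ ‖g‖ * dist s t := by
      intro s t hst
      obtain ⟨u, rfl⟩ := exists_add_of_le hst
      rw [hadd, ContinuousLinearMap.comp_apply, dist_eq_norm, ← map_sub]
      refine (hSb _ _).trans ?_
      rw [norm_sub_rev]
      refine (hinc hfg u).trans_eq ?_
      rw [NNReal.dist_eq, NNReal.coe_add, mul_comm]
      congr 1
      rw [sub_add_cancel_left, abs_neg, abs_of_nonneg u.coe_nonneg]
    refine LipschitzWith.of_dist_le_mul fun s t => ?_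
    rcases le_total s t with hst | hst
    · exact key s t hst
    · rw [dist_comm, dist_comm s]
      exact key t s hst
  have hcont : ∀ f : E, Continuous fun t => S t f := by
    intro f
    rw [Metric.continuous_iff]
    intro t ε hε
    obtain ⟨f', hf', g, hg⟩ := Metric.dense_iff.1 hd f (ε / 3) (by positivity)
    rw [Metric.mem_ball] at hf'
    obtain ⟨δ, hδ, hδ'⟩ := Metric.continuous_iff.1 (hlip hg).continuous t (ε / 3) (by positivity)
    refine ⟨δ, hδ, fun s hs => ?_⟩
    have h1 := hδ' s hs
    have h3 : ∀ t, dist (S t f) (S t f') ≤ dist f' f := by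
      intro t
      rw [dist_eq_norm, ← map_sub, dist_comm, dist_eq_norm]
      exact hSb t _
    have h4 := h3 t
    rw [dist_comm] at h4
    have := dist_triangle4 (S s f) (S s f') (S t f') (S t f)
    linarith [h3 s]
  have hgen : ∀ {f g : E}, (f, g) ∈ Γ →
      Tendsto (fun t : ℝ≥0 => (t : ℝ)⁻¹ • (S t f - f)) (𝓝[>] 0) (𝓝 g) := by
    intro f g hfg
    rw [Metric.tendsto_nhds]
    intro ε hε
    -- A single `n` suffices: by `hdist`, replacing the semigroup by the `n`-th exponential changes
    -- the difference quotient by at most `‖g - yosida R n f‖`, uniformly in `t`.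
    obtain ⟨n, hn⟩ := ((Metric.tendsto_nhds.1 (h.tendsto_yosida hd hfg)) (ε / 3)
      (by positivity)).exists
    have hder : Tendsto (fun t : ℝ =>
        t⁻¹ • (NormedSpace.exp (t • yosida R n) f - f)) (𝓝[>] 0) (𝓝 (yosida R n f)) := by
      have h1 := hasDerivAt_exp_smul_const (𝕂 := ℝ) (yosida R n) 0
      have h2 := (ContinuousLinearMap.apply ℝ E f).hasFDerivAt.comp_hasDerivAt (0 : ℝ) h1
      have h3 := h2.tendsto_slope_zero_right
      simpa using h3
    have hder' : Tendsto (fun t : ℝ≥0 =>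
        (t : ℝ)⁻¹ • (NormedSpace.exp ((t : ℝ) • yosida R n) f - f)) (𝓝[>] 0)
          (𝓝 (yosida R n f)) := by
      refine hder.comp (tendsto_nhdsWithin_iff.2 ⟨?_, ?_⟩)
      · exact (NNReal.continuous_coe.tendsto' 0 0 rfl).mono_left nhdsWithin_le_nhds
      · filter_upwards [self_mem_nhdsWithin] with t ht
        exact NNReal.coe_pos.2 ht
    filter_upwards [Metric.tendsto_nhds.1 hder' (ε / 3) (by positivity), self_mem_nhdsWithin]
      with t ht ht0
    have ht0' : (0 : ℝ) < t := NNReal.coe_pos.2 ht0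
    have h1 : dist ((t : ℝ)⁻¹ • (S t f - f))
        ((t : ℝ)⁻¹ • (NormedSpace.exp ((t : ℝ) • yosida R n) f - f)) ≤
          dist (yosida R n f) g := by
      rw [dist_eq_norm, ← smul_sub, sub_sub_sub_cancel_right, norm_smul,
        Real.norm_of_nonneg (by positivity), dist_comm, dist_eq_norm]
      calc _ ≤ (t : ℝ)⁻¹ * (t * ‖g - yosida R n f‖) := by
            gcongr
            exact hdist hfg t n
        _ = _ := by field_simp
    have := dist_triangle4 ((t : ℝ)⁻¹ • (S t f - f))
      ((t : ℝ)⁻¹ • (NormedSpace.exp ((t : ℝ) • yosida R n) f - f)) (yosida R n f) g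
    linarith
  have hcomm : ∀ t f, R 1 (S t f) = S t (R 1 f) := by
    intro t f
    refine tendsto_nhds_unique (((R 1).continuous.tendsto _).comp (hS t f)) ?_
    refine (hS t (R 1 f)).congr fun n => ?_
    have := ((h.commute_yosida n one_pos).smul_right (t : ℝ)).exp_right
    exact (congrArg (fun T : E →L[ℝ] E => T f) this).symm
  refine ⟨⟨S, h0, hadd, hcont⟩, fun f g => ⟨hgen, fun hfg => ?_⟩, ?_⟩
  -- The generator has no larger domain: applying `R 1` to the difference quotients gives `R 1 g = R
  -- 1 f - f`, hence `f = R 1 (f - g)` lies in the domain.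
  · have h1 : Tendsto (fun t : ℝ≥0 => (t : ℝ)⁻¹ • (S t (R 1 f) - R 1 f)) (𝓝[>] 0)
        (𝓝 (R 1 g)) := by
      refine (((R 1).continuous.tendsto _).comp hfg).congr fun t => ?_
      simp only [Function.comp_apply, map_smul, map_sub, hcomm]
    have hmem := h.mem_graph 1 one_pos f
    have h2 := tendsto_nhds_unique h1 (hgen hmem)
    have e : R 1 (f - g) = f := by
      rw [map_sub, h2]
      simp
    have := h.mem_graph 1 one_pos (f - g)
    rw [e] at this
    simpa using this
  · intro K hK hK0 hKadd hKsmul hKR t f hf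
    exact hK.mem_of_tendsto (hS t f) (Eventually.of_forall fun n =>
      exp_yosida_mem hK hK0 hKadd hKsmul (hKR _ (Nat.cast_add_one_pos n)) t.2 hf)

/-- **Hille–Yosida theorem** for quasi-contractive semigroups; closed convex cones that are
invariant under the resolvent are invariant under the semigroup. -/
theorem exists_semigroup [CompleteSpace E] (h : IsResolvent Γ ω R)
    (hd : Dense {f : E | ∃ g, (f, g) ∈ Γ}) :
    ∃ 𝒮 : C0Semigroup E,
      (∀ f g : E, (f, g) ∈ Γ ↔
        Tendsto (fun t : ℝ≥0 => (t : ℝ)⁻¹ • (𝒮.S t f - f)) (𝓝[>] 0) (𝓝 g)) ∧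
      ∀ K : Set E, IsClosed K → (0 : E) ∈ K → (∀ f ∈ K, ∀ g ∈ K, f + g ∈ K) →
        (∀ c : ℝ, 0 ≤ c → ∀ f ∈ K, c • f ∈ K) → (∀ s, ω < s → ∀ f ∈ K, R s f ∈ K) →
        ∀ t, ∀ f ∈ K, 𝒮.S t f ∈ K := by
  have hd' : Dense {f : E | ∃ g, (f, g) ∈ {p : E × E | (p.1, p.2 + ω • p.1) ∈ Γ}} := by
    refine hd.mono ?_
    rintro f ⟨g, hg⟩
    exact ⟨g - ω • f, by simpa using hg⟩
  obtain ⟨𝒱, hgen, hcone⟩ := h.shift.exists_contractionSemigroup hd'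
  have hexp : Tendsto (fun t : ℝ≥0 => Real.exp (ω * t)) (𝓝[>] 0) (𝓝 1) := by
    have : Continuous fun t : ℝ≥0 => Real.exp (ω * t) := by fun_prop
    exact (this.tendsto' 0 1 (by simp)).mono_left nhdsWithin_le_nhds
  have hexp' : Tendsto (fun t : ℝ≥0 => (t : ℝ)⁻¹ * (Real.exp (ω * t) - 1)) (𝓝[>] 0) (𝓝 ω) := by
    have h1 : HasDerivAt (fun t : ℝ => Real.exp (ω * t)) ω 0 := by
      simpa using ((hasDerivAt_id (0 : ℝ)).const_mul ω).exp
    have h2 := h1.tendsto_slope_zero_right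
    simp only [zero_add, mul_zero, Real.exp_zero, smul_eq_mul] at h2
    refine h2.comp (tendsto_nhdsWithin_iff.2 ⟨?_, ?_⟩)
    · exact (NNReal.continuous_coe.tendsto' 0 0 rfl).mono_left nhdsWithin_le_nhds
    · filter_upwards [self_mem_nhdsWithin] with t ht
      exact NNReal.coe_pos.2 ht
  refine ⟨⟨fun t => Real.exp (ω * t) • 𝒱.S t, ?_, ?_, ?_⟩, fun f g => ?_, ?_⟩
  · simp [𝒱.map_zero]
  · intro s t
    ext f
    simp only [𝒱.map_add, smul_apply, ContinuousLinearMap.comp_apply,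
      map_smul, smul_smul, NNReal.coe_add, mul_add, Real.exp_add]
    rw [mul_comm]
  · intro f
    have h1 : Continuous fun t : ℝ≥0 => Real.exp (ω * t) := by fun_prop
    exact h1.smul (𝒱.strongly_continuous f)
  · have h1 := hgen f (g - ω • f)
    simp only [mem_ofPred_eq, sub_add_cancel] at h1
    rw [h1]
    constructor
    · intro h2
      -- Product rule: `(e^{ωt} V f - f) / t = e^{ωt} (V f - f) / t + ((e^{ωt} - 1) / t) f`.
      have h3 := (hexp.smul h2).add (hexp'.smul_const f)
      rw [one_smul, sub_add_cancel] at h3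
      refine h3.congr fun t => ?_
      simp only [smul_apply]
      module
    · intro h2
      have h3 := (hexp.inv₀ one_ne_zero).smul (h2.sub (hexp'.smul_const f))
      rw [inv_one, one_smul ℝ (g - ω • f)] at h3
      refine h3.congr fun t => ?_
      simp only [smul_apply]
      have h4 : Real.exp (ω * t) ≠ 0 := (Real.exp_pos _).ne'
      rw [mul_smul, ← smul_sub, smul_comm]
      congr 1
      rw [sub_smul, one_smul, sub_sub_sub_cancel_right, ← smul_sub, smul_smul,
        inv_mul_cancel₀ h4, one_smul]
  · intro K hK hK0 hKadd hKsmul hKR t f hf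
    exact hKsmul _ (Real.exp_nonneg _) _ (hcone K hK hK0 hKadd hKsmul
      (fun s hs => hKR _ (by linarith)) t f hf)

end IsResolvent

end HilleYosida

/-! ### Positive operators on `L¹` and positive perturbations of resolvents. -/

section PositivePerturbation

variable {α : Type*} [MeasurableSpace α] {μ : Measure α}

/-- The integral, as a continuous linear functional on `L¹`. -/
noncomputable def massL (μ : Measure α) : Lp ℝ 1 μ →L[ℝ] ℝ := L1.integralCLM

theorem massL_apply (f : Lp ℝ 1 μ) : massL μ f = ∫ x, f x ∂μ :=
  (L1.integral_eq f).symm.trans (L1.integral_eq_integral f)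

/-- On the positive cone of `L¹` the norm is linear, so mass identities become norm estimates there.
-/
theorem massL_of_nonneg {f : Lp ℝ 1 μ} (hf : 0 ≤ f) : massL μ f = ‖f‖ := by
  rw [massL_apply, L1.norm_eq_integral_norm]
  refine integral_congr_ae ?_
  filter_upwards [(Lp.coeFn_nonneg f).2 hf] with x hx
  exact (Real.norm_of_nonneg hx).symm

theorem massL_posPart_add_negPart (f : Lp ℝ 1 μ) : massL μ f⁺ + massL μ f⁻ = ‖f‖ := by
  rw [← map_add, posPart_add_negPart, massL_of_nonneg (abs_nonneg f), norm_abs_eq_norm]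

/-- A positive operator on `L¹` is bounded by its bound on the positive cone. -/
theorem norm_le_of_positive {P : Lp ℝ 1 μ →ₗ[ℝ] Lp ℝ 1 μ} {C : ℝ}
    (hP : ∀ f, 0 ≤ f → 0 ≤ P f) (hC : ∀ f, 0 ≤ f → massL μ (P f) ≤ C * massL μ f)
    (f : Lp ℝ 1 μ) : ‖P f‖ ≤ C * ‖f‖ := by
  have h1 := hC _ (posPart_nonneg f)
  have h2 := hC _ (negPart_nonneg f)
  calc ‖P f‖ = ‖P f⁺ - P f⁻‖ := by rw [← map_sub, posPart_sub_negPart]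
    _ ≤ ‖P f⁺‖ + ‖P f⁻‖ := norm_sub_le _ _
    _ = massL μ (P f⁺) + massL μ (P f⁻) := by
        rw [massL_of_nonneg (hP _ (posPart_nonneg f)), massL_of_nonneg (hP _ (negPart_nonneg f))]
    _ ≤ C * (massL μ f⁺ + massL μ f⁻) := by linarith
    _ = C * ‖f‖ := by rw [massL_posPart_add_negPart]

theorem Lp_smul_nonneg {c : ℝ} (hc : 0 ≤ c) {f : Lp ℝ 1 μ} (hf : 0 ≤ f) : 0 ≤ c • f := by
  rw [← Lp.coeFn_nonneg] at hf ⊢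
  filter_upwards [hf, Lp.coeFn_smul c f] with x h1 h2
  rw [h2]
  exact mul_nonneg hc h1

/-- The Neumann series of a positive strict contraction on `L¹` is positive. -/
theorem tsum_pow_nonneg {Q : Lp ℝ 1 μ →L[ℝ] Lp ℝ 1 μ} (hQ : ‖Q‖ < 1)
    (hpos : ∀ f, 0 ≤ f → 0 ≤ Q f) {f : Lp ℝ 1 μ} (hf : 0 ≤ f) : 0 ≤ (∑' n : ℕ, Q ^ n) f := by
  have hs := (summable_geometric_of_norm_lt_one hQ).hasSum.mapL (ContinuousLinearMap.apply ℝ _ f)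
  refine ge_of_tendsto hs (Eventually.of_forall fun s => Finset.sum_nonneg fun n hn => ?_)
  clear hn
  induction n with
  | zero => simpa using hf
  | succ n ih =>
    rw [pow_succ']
    exact hpos _ ih

/-- Positive perturbation of a resolvent positive operator `T` on `L¹` by a positive operator `B`
for which the mass balance `∫ (T f + (1 + ε) B f) ≤ ω ∫ f` holds with some `ε > 0`: the resolvent
of `T + B` on the domain of `T`. -/
theorem exists_resolvent_of_positive_perturbation (T B : Lp ℝ 1 μ →ₗ.[ℝ] Lp ℝ 1 μ)
    (hTB : T.domain ≤ B.domain) {ω ε s : ℝ} (hε : 0 < ε) (hs : ω < s)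
    (hsolve : ∀ g, 0 ≤ g → ∃ f : T.domain, 0 ≤ (f : Lp ℝ 1 μ) ∧ s • (f : Lp ℝ 1 μ) - T f = g)
    (hinj : ∀ f : T.domain, s • (f : Lp ℝ 1 μ) - T f = 0 → f = 0)
    (hBpos : ∀ f : B.domain, 0 ≤ (f : Lp ℝ 1 μ) → 0 ≤ B f)
    (hmass : ∀ f : T.domain, 0 ≤ (f : Lp ℝ 1 μ) →
      massL μ (T f) + (1 + ε) * massL μ (B ⟨f, hTB f.2⟩) ≤ ω * massL μ f) :
    ∃ R : Lp ℝ 1 μ →L[ℝ] Lp ℝ 1 μ, (∀ g, (R g, s • R g - g) ∈ (T + B).graph) ∧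
      (∀ f g, (f, g) ∈ (T + B).graph → R (s • f - g) = f) ∧ ‖R‖ ≤ (s - ω)⁻¹ ∧
      ∀ g, 0 ≤ g → 0 ≤ R g := by
  let L : T.domain →ₗ[ℝ] Lp ℝ 1 μ := s • T.domain.subtype - T.toFun
  have hL : ∀ f, L f = s • (f : Lp ℝ 1 μ) - T f := fun _ => rfl
  have hLinj : Function.Injective L := (injective_iff_map_eq_zero L).2 hinj
  have hLsurj : Function.Surjective L := by
    intro g
    obtain ⟨f₁, -, h₁⟩ := hsolve _ (posPart_nonneg g)
    obtain ⟨f₂, -, h₂⟩ := hsolve _ (negPart_nonneg g)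
    refine ⟨f₁ - f₂, ?_⟩
    rw [map_sub, hL, hL, h₁, h₂, posPart_sub_negPart]
  let e : T.domain ≃ₗ[ℝ] Lp ℝ 1 μ := LinearEquiv.ofBijective L ⟨hLinj, hLsurj⟩
  have he : ∀ g, s • (e.symm g : Lp ℝ 1 μ) - T (e.symm g) = g := fun g => e.apply_symm_apply g
  have hepos : ∀ g, 0 ≤ g → 0 ≤ (e.symm g : Lp ℝ 1 μ) := by
    intro g hg
    obtain ⟨f, hf, h⟩ := hsolve g hg
    have : e.symm g = f := by
      rw [LinearEquiv.symm_apply_eq]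
      exact h.symm
    rwa [this]
  let Q₀ : Lp ℝ 1 μ →ₗ[ℝ] Lp ℝ 1 μ := B.toFun ∘ₗ Submodule.inclusion hTB ∘ₗ e.symm.toLinearMap
  have hQ₀ : ∀ g, Q₀ g = B ⟨e.symm g, hTB (e.symm g).2⟩ := fun _ => rfl
  have hQ₀pos : ∀ g, 0 ≤ g → 0 ≤ Q₀ g := fun g hg => hBpos _ (hepos g hg)
  -- With `f = (s - T)⁻¹ g`, the mass balance gives `(1 + ε) ∫ B f ≤ ∫ g - (s - ω) ∫ f ≤ ∫ g`. The
  -- factor `1 + ε` is what makes `Q₀ = B (s - T)⁻¹` a strict contraction.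
  have hQ₀mass : ∀ g, 0 ≤ g → massL μ (Q₀ g) ≤ (1 + ε)⁻¹ * massL μ g := by
    intro g hg
    have h1 := hmass (e.symm g) (hepos g hg)
    have h2 := congrArg (massL μ) (he g)
    rw [map_sub, map_smul, smul_eq_mul] at h2
    have h3 : 0 ≤ massL μ (e.symm g : Lp ℝ 1 μ) := by
      rw [massL_of_nonneg (hepos g hg)]
      positivity
    rw [← hQ₀] at h1
    rw [inv_mul_eq_div, le_div_iff₀ (by positivity)]
    nlinarith [mul_nonneg (sub_nonneg.2 hs.le) h3]
  let Q : Lp ℝ 1 μ →L[ℝ] Lp ℝ 1 μ :=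
    Q₀.mkContinuous (1 + ε)⁻¹ (norm_le_of_positive hQ₀pos hQ₀mass)
  have hQ : ‖Q‖ < 1 := lt_of_le_of_lt (LinearMap.mkContinuous_norm_le _ (by positivity) _)
    (inv_lt_one_of_one_lt₀ (by linarith))
  let N : Lp ℝ 1 μ →L[ℝ] Lp ℝ 1 μ := ∑' n : ℕ, Q ^ n
  have hN1 : ∀ g, N g - Q₀ (N g) = g := fun g =>
    congrArg (fun P : Lp ℝ 1 μ →L[ℝ] Lp ℝ 1 μ => P g) (mul_neg_geom_series Q hQ)
  have hN2 : ∀ g, N (g - Q₀ g) = g := fun g =>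
    congrArg (fun P : Lp ℝ 1 μ →L[ℝ] Lp ℝ 1 μ => P g) (geom_series_mul_neg Q hQ)
  have hNpos : ∀ g, 0 ≤ g → 0 ≤ N g := fun g hg => tsum_pow_nonneg hQ hQ₀pos hg
  -- The factorization `s - T - B = (1 - Q₀)(s - T)` is inverted factor by factor.
  let R₀ : Lp ℝ 1 μ →ₗ[ℝ] Lp ℝ 1 μ := T.domain.subtype ∘ₗ e.symm.toLinearMap ∘ₗ N.toLinearMap
  have hR₀ : ∀ g, R₀ g = (e.symm (N g) : Lp ℝ 1 μ) := fun _ => rfl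
  have hR₀pos : ∀ g, 0 ≤ g → 0 ≤ R₀ g := fun g hg => hepos _ (hNpos g hg)
  have hR₀eq : ∀ g, T (e.symm (N g)) + Q₀ (N g) = s • R₀ g - g := by
    intro g
    have h1 : T (e.symm (N g)) = s • R₀ g - N g := by
      rw [eq_sub_iff_add_eq, add_comm, ← eq_sub_iff_add_eq]
      exact (he (N g)).symm
    rw [h1, sub_add, sub_right_inj]
    exact hN1 g
  -- The amplification is not needed here: the surplus `ε ∫ Q₀ (N g)` is nonnegative and is dropped.
  have hR₀mass : ∀ g, 0 ≤ g → massL μ (R₀ g) ≤ (s - ω)⁻¹ * massL μ g := by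
    intro g hg
    have h1 := hmass (e.symm (N g)) (hR₀pos g hg)
    have h2 := congrArg (massL μ) (hR₀eq g)
    rw [map_add, map_sub, map_smul, smul_eq_mul] at h2
    have h3 : 0 ≤ massL μ (Q₀ (N g)) := by
      rw [massL_of_nonneg (hQ₀pos _ (hNpos g hg))]
      positivity
    rw [← hQ₀, ← hR₀] at h1
    rw [inv_mul_eq_div, le_div_iff₀ (by linarith)]
    nlinarith [mul_nonneg hε.le h3]
  refine ⟨R₀.mkContinuous (s - ω)⁻¹ (norm_le_of_positive hR₀pos hR₀mass), fun g => ?_,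
    fun f g hfg => ?_, LinearMap.mkContinuous_norm_le _ (by simpa using hs.le) _, hR₀pos⟩
  · rw [LinearPMap.mem_graph_iff]
    exact ⟨⟨R₀ g, (e.symm (N g)).2, hTB (e.symm (N g)).2⟩, rfl, hR₀eq g⟩
  · rw [LinearPMap.mem_graph_iff] at hfg
    obtain ⟨⟨f', hf'T, hf'B⟩, rfl, rfl⟩ := hfg
    have h1 : e.symm (L ⟨f', hf'T⟩) = ⟨f', hf'T⟩ := e.symm_apply_apply _
    have h2 : Q₀ (L ⟨f', hf'T⟩) = B ⟨f', hf'B⟩ := by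
      rw [hQ₀]
      simp only [h1]
    have h3 : s • f' - (T + B) ⟨f', hf'T, hf'B⟩ = L ⟨f', hf'T⟩ - Q₀ (L ⟨f', hf'T⟩) := by
      rw [h2, hL]
      exact sub_add_eq_sub_sub _ _ _
    change R₀ (s • f' - (T + B) ⟨f', hf'T, hf'B⟩) = f'
    rw [h3, hR₀, hN2, h1]

end PositivePerturbation

namespace GrowthFrag

/-! ### The weighted measure and exhaustion of the half-line -/

theorem weight_pos (m : ℝ) {x : ℝ} (hx : 0 < x) : 0 < 1 + x ^ m := by
  have := Real.rpow_pos_of_pos hx m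
  linarith

theorem measurable_weight (m : ℝ) : Measurable fun x : ℝ => ENNReal.ofReal (1 + x ^ m) := by
  fun_prop

theorem weight_smul_ae_eq (m : ℝ) (f : ℝ → ℝ) :
    (fun x => (ENNReal.ofReal (1 + x ^ m)).toReal • f x) =ᵐ[volume.restrict (Ioi 0)]
      fun x => (1 + x ^ m) * f x := by
  filter_upwards [ae_restrict_mem measurableSet_Ioi] with x hx
  rw [ENNReal.toReal_ofReal (weight_pos m hx).le, smul_eq_mul]

theorem memLp_weightMeasure_iff {m : ℝ} {f : ℝ → ℝ} :
    MemLp f 1 (weightMeasure m) ↔ IntegrableOn (fun x => (1 + x ^ m) * f x) (Ioi 0) := by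
  rw [memLp_one_iff_integrable, weightMeasure, halfLine,
    integrable_withDensity_iff_integrable_smul' (measurable_weight m) (by simp)]
  exact integrable_congr (weight_smul_ae_eq m f)

theorem integral_weightMeasure (m : ℝ) (f : ℝ → ℝ) :
    ∫ x, f x ∂weightMeasure m = ∫ x in Ioi 0, (1 + x ^ m) * f x := by
  rw [weightMeasure, halfLine,
    integral_withDensity_eq_integral_toReal_smul (measurable_weight m) (by simp)]
  exact integral_congr_ae (weight_smul_ae_eq m f)

theorem halfLine_le_weightMeasure (m : ℝ) : halfLine ≤ weightMeasure m := by
  conv_lhs => rw [← withDensity_one (μ := halfLine)]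
  refine withDensity_mono ?_
  filter_upwards [ae_restrict_mem measurableSet_Ioi] with x hx
  have := Real.rpow_pos_of_pos (mem_Ioi.1 hx) m
  simpa using this.le

theorem integrableOn_of_memLp {m : ℝ} {f : ℝ → ℝ} (hf : MemLp f 1 (weightMeasure m)) :
    IntegrableOn f (Ioi 0) :=
  memLp_one_iff_integrable.1 (hf.mono_measure (halfLine_le_weightMeasure m))

theorem ae_halfLine_iff {p : ℝ → Prop} :
    (∀ᵐ x ∂halfLine, p x) ↔ ∀ᵐ x, 0 < x → p x := by
  rw [halfLine, ae_restrict_iff' measurableSet_Ioi]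
  rfl

theorem aecover_halfLine :
    AECover (volume.restrict (Ioi (0 : ℝ))) atTop
      fun n : ℕ => Ioc (1 / ((n : ℝ) + 1)) (n + 1) := by
  refine (aecover_Ioi_of_Ioi tendsto_one_div_add_atTop_nhds_zero_nat).inter (aecover_Iic ?_)
  exact tendsto_atTop_add_const_right _ _ tendsto_natCast_atTop_atTop

theorem one_div_succ_le_succ (n : ℕ) : 1 / ((n : ℝ) + 1) ≤ 1 ∧ (1 : ℝ) ≤ n + 1 := by
  have h0 : (0 : ℝ) ≤ n := n.cast_nonneg
  exact ⟨by rw [div_le_one (by positivity)]; linarith, by linarith⟩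

theorem setIntegral_halfLine_eq (h : ℝ → ℝ) (n : ℕ) :
    ∫ x in Ioc (1 / ((n : ℝ) + 1)) (n + 1), h x ∂(volume.restrict (Ioi 0)) =
      ∫ x in (1 / ((n : ℝ) + 1))..(n + 1), h x := by
  have h1 := one_div_succ_le_succ n
  rw [intervalIntegral.integral_of_le (h1.1.trans h1.2),
    Measure.restrict_restrict measurableSet_Ioc, inter_eq_left.2]
  intro x hx
  exact lt_trans (by positivity) hx.1

theorem tendsto_intervalIntegral_halfLine {h : ℝ → ℝ} (hh : IntegrableOn h (Ioi 0)) :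
    Tendsto (fun n : ℕ => ∫ x in (1 / ((n : ℝ) + 1))..(n + 1), h x) atTop
      (𝓝 (∫ x in Ioi 0, h x)) := by
  refine (aecover_halfLine.integral_tendsto_of_countably_generated hh).congr fun n => ?_
  exact setIntegral_halfLine_eq h n

/-- Monotone convergence along an exhaustion. Only intervals containing `1` are tested, so that
bounds valid for `α ≤ 1` can be used. -/
theorem integrableOn_halfLine_of_bounded {h : ℝ → ℝ} (h0 : ∀ᵐ x ∂halfLine, 0 ≤ h x)
    (hi : ∀ α β, 0 < α → α ≤ β → IntervalIntegrable h volume α β) {I : ℝ}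
    (hI : ∀ α β, 0 < α → α ≤ 1 → 1 ≤ β → ∫ x in α..β, h x ≤ I) :
    IntegrableOn h (Ioi 0) := by
  refine aecover_halfLine.integrable_of_integral_bounded_of_nonneg_ae I (fun n => ?_) h0
    (Eventually.of_forall fun n => ?_)
  · have h1 := one_div_succ_le_succ n
    have h2 := hi (1 / ((n : ℝ) + 1)) (n + 1) (by positivity) (h1.1.trans h1.2)
    rw [intervalIntegrable_iff_integrableOn_Ioc_of_le (h1.1.trans h1.2)] at h2
    exact h2.mono_measure Measure.restrict_le_self
  · have h1 := one_div_succ_le_succ n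
    rw [setIntegral_halfLine_eq]
    exact hI _ _ (by positivity) h1.1 h1.2

/-! ### Locally absolutely continuous functions on the half-line -/

/-- The function is bounded above by some `C` on the interval, and the exponential is Lipschitz with
constant `exp C` on `(-∞, C]`. -/
theorem _root_.AbsolutelyContinuousOnInterval.exp {f : ℝ → ℝ} {a b : ℝ}
    (hf : AbsolutelyContinuousOnInterval f a b) :
    AbsolutelyContinuousOnInterval (fun x => Real.exp (f x)) a b := by
  obtain ⟨C, hC⟩ := hf.exists_bound
  unfold AbsolutelyContinuousOnInterval at hf ⊢
  refine squeeze_zero' (Eventually.of_forall fun _ => Finset.sum_nonneg fun i hi => dist_nonneg) ?_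
    (by simpa using hf.const_mul (Real.exp C))
  rw [eventually_inf_principal]
  filter_upwards with (n, I) hnI
  simp only [Finset.mul_sum]
  gcongr with i hi
  have h1 := hC _ (hnI.left i hi).left
  have h2 := hC _ (hnI.left i hi).right
  have := (convex_Iic C).norm_image_sub_le_of_norm_deriv_le (f := Real.exp) (C := Real.exp C)
    (fun x _ => Real.differentiableAt_exp)
    (fun x hx => by
      rw [Real.deriv_exp, Real.norm_of_nonneg (Real.exp_nonneg _)]
      exact Real.exp_le_exp.2 hx)
    (le_of_abs_le h2) (le_of_abs_le h1)
  simpa [dist_eq_norm] using this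

theorem ACLoc.mul {F G : ℝ → ℝ} (hF : ACLoc F) (hG : ACLoc G) : ACLoc fun x => F x * G x :=
  fun α β h h' => (hF α β h h').fun_mul (hG α β h h')

theorem ACLoc.exp {F : ℝ → ℝ} (hF : ACLoc F) : ACLoc fun x => Real.exp (F x) :=
  fun α β h h' => (hF α β h h').exp

theorem ACLoc.neg {F : ℝ → ℝ} (hF : ACLoc F) : ACLoc fun x => -F x :=
  fun α β h h' => (hF α β h h').neg

theorem ACLoc.eqOn_const {F : ℝ → ℝ} (hF : ACLoc F) (h : ∀ᵐ x ∂halfLine, HasDerivAt F 0 x) :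
    ∀ x, 0 < x → F x = F 1 := by
  rw [ae_halfLine_iff] at h
  intro x hx
  have hpos : 0 < min x 1 := lt_min hx one_pos
  obtain ⟨C, hC⟩ := (hF (min x 1) (max x 1) hpos min_le_max).const_of_ae_hasDerivAt_zero (by
    filter_upwards [h] with y hy hy'
    rw [uIcc_of_le min_le_max] at hy'
    exact hy (lt_of_lt_of_le hpos hy'.1))
  rw [uIcc_of_le min_le_max] at hC
  rw [hC x ⟨min_le_left _ _, le_max_left _ _⟩, hC 1 ⟨min_le_right _ _, le_max_right _ _⟩]

theorem ACLoc.nonneg_of_ae {F : ℝ → ℝ} (hF : ACLoc F) (h : ∀ᵐ x ∂halfLine, 0 ≤ F x) :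
    ∀ x, 0 < x → 0 ≤ F x := by
  intro x hx
  have : EqOn (fun x => |F x|) F (Ioi 0) :=
    Measure.eqOn_open_of_ae_eq (μ := volume) (h.mono fun x hx => abs_of_nonneg hx) isOpen_Ioi
      hF.continuousOn.abs hF.continuousOn
  rw [← this hx]
  exact abs_nonneg _

theorem acLoc_weight (m : ℝ) : ACLoc fun x => 1 + x ^ m := by
  intro α β hα hαβ
  refine ContDiffOn.absolutelyContinuousOnInterval fun x hx => ?_
  rw [uIcc_of_le hαβ] at hx
  exact (contDiffAt_const.add (Real.contDiffAt_rpow_const_of_ne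
    (lt_of_lt_of_le hα hx.1).ne')).contDiffWithinAt

theorem hasDerivAt_weight (m : ℝ) {x : ℝ} (hx : 0 < x) :
    HasDerivAt (fun x : ℝ => 1 + x ^ m) (m * x ^ (m - 1)) x :=
  (Real.hasDerivAt_rpow_const (Or.inl hx.ne')).const_add 1

/-- Locally integrable functions on `(0, ∞)`. -/
def LocInt (k : ℝ → ℝ) : Prop :=
  ∀ α β : ℝ, 0 < α → α ≤ β → IntervalIntegrable k volume α β

theorem LocInt.intervalIntegrable {k : ℝ → ℝ} (hk : LocInt k) {x y : ℝ} (hx : 0 < x) (hy : 0 < y) :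
    IntervalIntegrable k volume x y := by
  rcases le_total x y with h | h
  · exact hk x y hx h
  · exact (hk y x hy h).symm

theorem LocInt.acLoc {k : ℝ → ℝ} (hk : LocInt k) : ACLoc fun x => ∫ t in (1 : ℝ)..x, k t := by
  intro α β hα hαβ
  have h1 : 0 < min α 1 := lt_min hα one_pos
  have h2 : min α 1 ≤ max β 1 := (min_le_left _ _).trans (hαβ.trans (le_max_left _ _))
  refine ((hk (min α 1) (max β 1) h1 h2).absolutelyContinuousOnInterval_intervalIntegral
    (c := 1) ?_).mono ?_
  · rw [uIcc_of_le h2]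
    exact ⟨min_le_right _ _, le_max_right _ _⟩
  · rw [uIcc_of_le h2, uIcc_of_le hαβ]
    exact Icc_subset_Icc (min_le_left _ _) (le_max_left _ _)

theorem ae_halfLine_of_forall_interval {p : ℝ → Prop}
    (h : ∀ α β : ℝ, 0 < α → α ≤ 1 → 1 ≤ β → ∀ᵐ x, x ∈ Icc α β → p x) :
    ∀ᵐ x ∂halfLine, p x := by
  rw [ae_halfLine_iff]
  have h1 : ∀ n : ℕ, ∀ᵐ x : ℝ, x ∈ Icc (1 / ((n : ℝ) + 1)) (n + 1) → p x := fun n =>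
    h _ _ (by positivity) (one_div_succ_le_succ n).1 (one_div_succ_le_succ n).2
  filter_upwards [ae_all_iff.2 h1] with x hx hx0
  obtain ⟨n, hn⟩ := exists_nat_gt (max x (1 / x))
  have h1 : x < n := lt_of_le_of_lt (le_max_left _ _) hn
  have h2 : 1 / x < n := lt_of_le_of_lt (le_max_right _ _) hn
  refine hx n ⟨?_, by linarith⟩
  rw [div_le_iff₀ (by linarith)]
  rw [div_lt_iff₀ hx0] at h2
  nlinarith

theorem LocInt.ae_hasDerivAt {k : ℝ → ℝ} (hk : LocInt k) :
    ∀ᵐ x ∂halfLine, HasDerivAt (fun x => ∫ t in (1 : ℝ)..x, k t) (k x) x := by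
  refine ae_halfLine_of_forall_interval fun α β hα hα1 hβ1 => ?_
  have h := (hk α β hα (hα1.trans hβ1)).ae_hasDerivAt_integral
  rw [uIcc_of_le (hα1.trans hβ1)] at h
  filter_upwards [h] with x hx hx'
  exact hx hx' 1 ⟨hα1, hβ1⟩

theorem LocInt.primitive_mono {k : ℝ → ℝ} (hk : LocInt k) (h0 : ∀ᵐ x ∂halfLine, 0 ≤ k x)
    {x y : ℝ} (hx : 0 < x) (hxy : x ≤ y) :
    ∫ t in (1 : ℝ)..x, k t ≤ ∫ t in (1 : ℝ)..y, k t := by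
  have h1 := intervalIntegral.integral_add_adjacent_intervals
    (hk.intervalIntegrable one_pos hx) (hk x y hx hxy)
  rw [← h1]
  have : 0 ≤ ∫ t in x..y, k t := by
    rw [intervalIntegral.integral_of_le hxy]
    refine setIntegral_nonneg_of_ae_restrict ?_
    exact ae_restrict_of_ae_restrict_of_subset (fun z hz => hx.trans hz.1) h0
  linarith

end GrowthFrag

namespace GrowthFrag

/-! ### The transport operator -/

/-- The standing assumptions on the growth rate `r` and the absorption rate `q`. -/
structure TransportCoeff (r q : ℝ → ℝ) (r₀ r₁ : ℝ) : Prop where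
  r_meas : AEMeasurable r halfLine
  r_int : LocallyIntegrableOn (fun x => 1 / r x) (Ioi 0)
  r₀_nonneg : 0 ≤ r₀
  r₁_nonneg : 0 ≤ r₁
  r_bound : ∀ x, 0 < x → 0 < r x ∧ r x ≤ r₀ + r₁ * x
  q_loc : LocEssBounded q
  q_nonneg : ∀ᵐ x ∂halfLine, 0 ≤ q x

namespace TransportCoeff

variable {m : ℝ} {r q : ℝ → ℝ} {r₀ r₁ : ℝ} {f : X m} {F : ℝ → ℝ}

theorem ae_coeff_mono {p : ℝ → Prop} (h : ∀ᵐ x ∂halfLine, p x) {α β : ℝ} (hα : 0 ≤ α) :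
    ∀ᵐ x ∂(volume.restrict (Ioc α β)), p x :=
  ae_restrict_of_ae_restrict_of_subset (fun _ hz => lt_of_le_of_lt hα hz.1) h

theorem locInt_inv (h : TransportCoeff r q r₀ r₁) : LocInt fun x => 1 / r x := by
  intro α β hα hαβ
  rw [intervalIntegrable_iff_integrableOn_Icc_of_le hαβ]
  exact h.r_int.integrableOn_compact_subset (fun x hx => lt_of_lt_of_le hα hx.1) isCompact_Icc

theorem locInt (h : TransportCoeff r q r₀ r₁) (s : ℝ) : LocInt fun x => (s + q x) / r x := by
  intro α β hα hαβ
  have h1 := h.locInt_inv α β hα hαβ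
  rw [intervalIntegrable_iff_integrableOn_Ioc_of_le hαβ] at h1 ⊢
  obtain ⟨M, hM⟩ := h.q_loc.2 β
  have h2 : IntegrableOn (fun x => (s + q x) * (1 / r x)) (Ioc α β) := by
    refine Integrable.bdd_mul (c := |s| + M) h1 ?_ ?_
    · have hq : AEMeasurable q (volume.restrict (Ioc α β)) :=
        h.q_loc.1.mono_measure (Measure.restrict_mono (fun x hx => hα.trans hx.1) le_rfl)
      exact (hq.const_add s).aestronglyMeasurable
    · filter_upwards [ae_restrict_of_ae_restrict_of_subset (Ioc_subset_Ioc_left hα.le) hM]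
        with x hx
      exact (norm_add_le _ _).trans (by simpa using hx)
  simpa [div_eq_mul_inv] using h2

theorem coeff_nonneg (h : TransportCoeff r q r₀ r₁) {s : ℝ} (hs : 0 ≤ s) :
    ∀ᵐ x ∂halfLine, 0 ≤ (s + q x) / r x := by
  filter_upwards [h.q_nonneg, ae_restrict_mem measurableSet_Ioi] with x hx hx0
  exact div_nonneg (add_nonneg hs hx) (h.r_bound x hx0).1.le

/-- Since `r` grows at most linearly, transport increases the weighted mass at a bounded relative
rate. -/
theorem growth_weight_le (h : TransportCoeff r q r₀ r₁) (hm : 1 < m) {x : ℝ} (hx : 0 < x) :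
    r x * (m * x ^ (m - 1)) ≤ m * (r₀ + r₁) * (1 + x ^ m) := by
  have h0 : 0 < x ^ (m - 1) := Real.rpow_pos_of_pos hx _
  have h1 : x ^ (m - 1) ≤ 1 + x ^ m := by
    rcases le_total x 1 with hx1 | hx1
    · have := Real.rpow_le_one hx.le hx1 (by linarith : 0 ≤ m - 1)
      have := Real.rpow_pos_of_pos hx m
      linarith
    · have := Real.rpow_le_rpow_of_exponent_le hx1 (by linarith : m - 1 ≤ m)
      linarith
  have h2 : x * x ^ (m - 1) = x ^ m := by
    rw [mul_comm, ← Real.rpow_add_one hx.ne']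
    simp
  calc r x * (m * x ^ (m - 1)) ≤ (r₀ + r₁ * x) * (m * x ^ (m - 1)) := by
        have := (h.r_bound x hx).2
        gcongr
    _ = m * (r₀ * x ^ (m - 1) + r₁ * (x * x ^ (m - 1))) := by ring
    _ ≤ m * (r₀ * (1 + x ^ m) + r₁ * (1 + x ^ m)) := by
        rw [h2]
        have := h.r₀_nonneg
        have := h.r₁_nonneg
        gcongr
        linarith
    _ = _ := by ring

theorem tendsto_primitive_zero {k : ℝ → ℝ} (hk : IntegrableOn k (Ioi 0)) :
    Tendsto (fun x => ∫ t in (0 : ℝ)..x, k t) (𝓝[>] 0) (𝓝 0) := by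
  have hi : IntervalIntegrable k volume 0 1 := by
    rw [intervalIntegrable_iff_integrableOn_Ioc_of_le zero_le_one]
    exact hk.mono_set Ioc_subset_Ioi_self
  have h1 := (hi.absolutelyContinuousOnInterval_intervalIntegral (c := 0) (by simp)).continuousOn
  rw [uIcc_of_le zero_le_one] at h1
  have h2 := (h1 0 (by simp)).tendsto
  rw [intervalIntegral.integral_same] at h2
  refine h2.mono_left ?_
  rw [← nhdsWithin_Ioc_eq_nhdsGT (zero_lt_one (α := ℝ))]
  exact nhdsWithin_mono _ Ioc_subset_Icc_self

/-- The representative of `r f` vanishes at `0`, whether or not `1 / r` is integrable there. -/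
theorem tendsto_zero (h : TransportCoeff r q r₀ r₁) (hF : IsTransportRep m r q f F) :
    Tendsto F (𝓝[>] 0) (𝓝 0) := by
  have hF' : IntegrableOn (deriv F) (Ioi 0) := integrableOn_of_memLp hF.memLp_deriv
  have hi : IntervalIntegrable (deriv F) volume 0 1 := by
    rw [intervalIntegrable_iff_integrableOn_Ioc_of_le zero_le_one]
    exact hF'.mono_set Ioc_subset_Ioi_self
  have hprim := tendsto_primitive_zero hF'
  -- `F` has a limit `l` at `0` because its derivative is integrable there.
  set l := F 1 - ∫ t in (0 : ℝ)..1, deriv F t with hl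
  have hlim : Tendsto F (𝓝[>] 0) (𝓝 l) := by
    have h1 : Tendsto (fun x => l + ∫ t in (0 : ℝ)..x, deriv F t) (𝓝[>] 0) (𝓝 l) := by
      simpa using hprim.const_add l
    refine h1.congr' ?_
    filter_upwards [Ioc_mem_nhdsGT (zero_lt_one (α := ℝ))] with x hx
    have h2 := (hF.ac x 1 hx.1 hx.2).integral_deriv_eq_sub
    have h3 := intervalIntegral.integral_add_adjacent_intervals
      (hi.mono_set (c := 0) (d := x) (by
        rw [uIcc_of_le hx.1.le, uIcc_of_le zero_le_one]
        exact Icc_subset_Icc_right hx.2))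
      (hi.mono_set (c := x) (d := 1) (by
        rw [uIcc_of_le hx.2, uIcc_of_le zero_le_one]
        exact Icc_subset_Icc_left hx.1.le))
    rw [hl]
    linarith
  by_contra hne
  have hl0 : l ≠ 0 := fun h0 => hne (h0 ▸ hlim)
  refine hne (hF.boundary ?_)
  -- If `l ≠ 0`, then `1 / r ≤ (2 / |l|) |f|` near `0`, so `1 / r` is integrable there. The boundary
  -- condition then applies and forces the limit to vanish.
  have hlpos : 0 < |l| := abs_pos.2 hl0
  have hev : ∀ᶠ x in 𝓝[>] 0, |l| / 2 < |F x| :=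
    hlim.abs.eventually (lt_mem_nhds (by linarith))
  obtain ⟨δ, hδ, hδ'⟩ := mem_nhdsGT_iff_exists_Ioo_subset.1 hev
  refine ⟨Ioo 0 δ, Ioo_mem_nhdsGT hδ, ?_⟩
  have hf : IntegrableOn f (Ioo 0 δ) :=
    (integrableOn_of_memLp (Lp.memLp f)).mono_set Ioo_subset_Ioi_self
  refine Integrable.mono' (hf.norm.const_mul (2 / |l|)) ?_ ?_
  · have hr : AEMeasurable r (volume.restrict (Ioo 0 δ)) :=
      h.r_meas.mono_measure (Measure.restrict_mono Ioo_subset_Ioi_self le_rfl)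
    exact (hr.const_div 1).aestronglyMeasurable
  · have hFe : ∀ᵐ x ∂(volume.restrict (Ioo 0 δ)), F x = r x * f x :=
      ae_restrict_of_ae_restrict_of_subset Ioo_subset_Ioi_self hF.eq
    filter_upwards [hFe, ae_restrict_mem measurableSet_Ioo] with x hx hx'
    have hr := (h.r_bound x hx'.1).1
    have h1 : |l| / 2 < |F x| := hδ' hx'
    rw [hx, abs_mul, abs_of_pos hr] at h1
    rw [Real.norm_of_nonneg (by positivity), Real.norm_eq_abs, div_le_iff₀ hr,
      div_mul_eq_mul_div, div_mul_eq_mul_div, le_div_iff₀ hlpos]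
    linarith

theorem transportOp_coeFn (hF : IsTransportRep m r q f F) (hf : f ∈ (transportOp m r q).domain) :
    ∀ᵐ x ∂halfLine, transportOp m r q ⟨f, hf⟩ x = -deriv F x - q x * f x := by
  have h1 : transportOp m r q ⟨f, hf⟩ = hF.memLp.toLp :=
    IsTransportRep.toLp_eq hf.choose_spec hF
  rw [h1, ← ae_weightMeasure m]
  exact hF.memLp.coeFn_toLp

theorem mem_domain_iff : f ∈ (transportOp m r q).domain ↔ ∃ F, IsTransportRep m r q f F :=
  Iff.rfl

/-- `s - T` is injective. -/
theorem injective (h : TransportCoeff r q r₀ r₁) {s : ℝ} (hs : 0 ≤ s)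
    (f : (transportOp m r q).domain) (hf : s • (f : X m) - transportOp m r q f = 0) : f = 0 := by
  obtain ⟨f, hfd⟩ := f
  obtain ⟨F, hF⟩ := mem_domain_iff.1 hfd
  have heq : ∀ᵐ x ∂halfLine, s * f x + (deriv F x + q x * f x) = 0 := by
    have h1 : ∀ᵐ x ∂halfLine, (0 : X m) x = 0 := by
      rw [← ae_weightMeasure m]
      exact Lp.coeFn_zero ℝ 1 (weightMeasure m)
    have h2 : ∀ᵐ x ∂halfLine,
        (s • f - transportOp m r q ⟨f, hfd⟩ : X m) x =
          (s • f : X m) x - transportOp m r q ⟨f, hfd⟩ x := by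
      rw [← ae_weightMeasure m]
      exact Lp.coeFn_sub _ _
    rw [hf] at h2
    filter_upwards [h1, h2, coeFn_smul' s f, transportOp_coeFn hF hfd] with x e1 e2 e3 e4
    rw [e1, e3, e4] at e2
    linarith
  -- Integrating factor: `exp Φ · F` has zero derivative almost everywhere, hence is constant. Since
  -- `Φ ≤ 0` on `(0, 1]` and `F → 0` at `0`, the constant is zero.
  set Φ : ℝ → ℝ := fun x => ∫ t in (1 : ℝ)..x, (s + q t) / r t with hΦ
  have hE : ACLoc fun x => Real.exp (Φ x) := (h.locInt s).acLoc.exp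
  have hconst := (hE.mul hF.ac).eqOn_const (by
    filter_upwards [heq, hF.eq, (h.locInt s).ae_hasDerivAt, hF.ac.ae_differentiableAt,
      ae_restrict_mem measurableSet_Ioi] with x e1 e2 e3 e4 hx
    have hr := (h.r_bound x hx).1
    refine (e3.exp.mul e4.hasDerivAt).congr_deriv ?_
    have e5 : deriv F x = -((s + q x) / r x * F x) := by
      rw [e2, ← mul_assoc, div_mul_cancel₀ _ hr.ne']
      linarith
    rw [e5]
    ring)
  have hc : Real.exp (Φ 1) * F 1 = 0 := by
    have h1 : Tendsto (fun x => |F x|) (𝓝[>] 0) (𝓝 0) := by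
      simpa using (h.tendsto_zero hF).abs
    have h2 : |Real.exp (Φ 1) * F 1| ≤ 0 := by
      refine ge_of_tendsto h1 ?_
      filter_upwards [Ioc_mem_nhdsGT (zero_lt_one (α := ℝ))] with x hx
      rw [← hconst x hx.1, abs_mul, abs_of_pos (Real.exp_pos _)]
      have h3 : Φ x ≤ Φ 1 := (h.locInt s).primitive_mono (h.coeff_nonneg hs) hx.1 hx.2
      have h4 : Φ 1 = 0 := by simp [hΦ]
      have h5 : Real.exp (Φ x) ≤ 1 := by
        rw [Real.exp_le_one_iff]
        linarith
      exact mul_le_of_le_one_left (abs_nonneg _) h5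
    exact abs_nonpos_iff.1 h2
  have hf0 : f = 0 := by
    rw [Lp.eq_zero_iff_ae_eq_zero, EventuallyEq, ae_weightMeasure]
    filter_upwards [hF.eq, ae_restrict_mem measurableSet_Ioi] with x e1 hx
    have e2 := hconst x hx
    rw [hc, e1] at e2
    have hr := (h.r_bound x hx).1
    simpa [hr.ne', (Real.exp_pos _).ne'] using e2
  subst hf0
  rfl

/-- Integrated form of the product rule for a locally absolutely continuous function and the
weight. -/
theorem integral_deriv_weight (hF : ACLoc F) {α β : ℝ} (hα : 0 < α) (hαβ : α ≤ β) :
    ∫ x in α..β, (deriv F x * (1 + x ^ m) + F x * (m * x ^ (m - 1))) =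
      F β * (1 + β ^ m) - F α * (1 + α ^ m) := by
  rw [← (hF α β hα hαβ).integral_deriv_mul_eq_sub (acLoc_weight m α β hα hαβ)]
  refine intervalIntegral.integral_congr fun x hx => ?_
  rw [uIcc_of_le hαβ] at hx
  simp only [(hasDerivAt_weight m (lt_of_lt_of_le hα hx.1)).deriv]

theorem intervalIntegrable_weight_deriv (hF : ACLoc F) {α β : ℝ} (hα : 0 < α) (hαβ : α ≤ β) :
    IntervalIntegrable (fun x => F x * (m * x ^ (m - 1))) volume α β := by
  refine ContinuousOn.intervalIntegrable ?_
  rw [uIcc_of_le hαβ]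
  have hsub : Icc α β ⊆ Ioi 0 := fun x hx => lt_of_lt_of_le hα hx.1
  refine (hF.continuousOn.mono hsub).mul (continuousOn_const.mul ?_)
  exact continuousOn_id.rpow_const fun x hx => Or.inl (hsub hx).ne'

/-- The mass balance of the transport operator on nonnegative functions. -/
theorem massL_transportOp_le (h : TransportCoeff r q r₀ r₁) (hm : 1 < m)
    (f : (transportOp m r q).domain) (hf : 0 ≤ (f : X m)) :
    massL (weightMeasure m) (transportOp m r q f) ≤
      m * (r₀ + r₁) * massL (weightMeasure m) (f : X m) -
        ∫ x, q x * (f : X m) x ∂weightMeasure m := by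
  obtain ⟨f, hfd⟩ := f
  obtain ⟨F, hF⟩ := mem_domain_iff.1 hfd
  have hf' : ∀ᵐ x ∂halfLine, 0 ≤ f x := by
    rw [← ae_weightMeasure m]
    exact (Lp.coeFn_nonneg f).2 hf
  have hFpos : ∀ x, 0 < x → 0 ≤ F x := hF.ac.nonneg_of_ae (by
    filter_upwards [hf', hF.eq, ae_restrict_mem measurableSet_Ioi] with x e1 e2 hx
    rw [e2]
    exact mul_nonneg (h.r_bound x hx).1.le e1)
  set K := m * (r₀ + r₁) with hK
  have hfi : IntegrableOn (fun x => (1 + x ^ m) * f x) (Ioi 0) :=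
    memLp_weightMeasure_iff.1 (Lp.memLp f)
  have hFi : IntegrableOn (fun x => (1 + x ^ m) * deriv F x) (Ioi 0) :=
    memLp_weightMeasure_iff.1 hF.memLp_deriv
  -- Integration by parts on compact intervals. The boundary term at the right end has a favourable
  -- sign and is dropped, so no decay at infinity is needed; the one at the left end tends to zero.
  have key : -∫ x in Ioi 0, (1 + x ^ m) * deriv F x ≤ K * ∫ x in Ioi 0, (1 + x ^ m) * f x := by
    have hlim : Tendsto (fun n : ℕ => F (1 / ((n : ℝ) + 1)) * (1 + (1 / ((n : ℝ) + 1)) ^ m) +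
        K * ∫ x in (1 / ((n : ℝ) + 1))..(n + 1), (1 + x ^ m) * f x) atTop
          (𝓝 (0 + K * ∫ x in Ioi 0, (1 + x ^ m) * f x)) := by
      refine Tendsto.add ?_ ((tendsto_intervalIntegral_halfLine hfi).const_mul K)
      have h1 : Tendsto (fun n : ℕ => 1 / ((n : ℝ) + 1)) atTop (𝓝[>] 0) :=
        tendsto_nhdsWithin_iff.2 ⟨tendsto_one_div_add_atTop_nhds_zero_nat,
          Eventually.of_forall fun n => mem_Ioi.2 (by positivity)⟩
      have h2 := (h.tendsto_zero hF).comp h1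
      have h3 : Tendsto (fun n : ℕ => F (1 / ((n : ℝ) + 1)) * 2) atTop (𝓝 0) := by
        simpa using h2.mul_const 2
      refine squeeze_zero (fun n => ?_) (fun n => ?_) h3
      · exact mul_nonneg (hFpos _ (by positivity)) (weight_pos m (by positivity)).le
      · refine mul_le_mul_of_nonneg_left ?_ (hFpos _ (by positivity))
        have := Real.rpow_le_one (by positivity) (one_div_succ_le_succ n).1
          (by linarith : 0 ≤ m)
        linarith
    rw [zero_add] at hlim
    refine le_of_tendsto_of_tendsto (tendsto_intervalIntegral_halfLine hFi).neg hlim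
      (Eventually.of_forall fun n => ?_)
    obtain ⟨hα1, hβ1⟩ := one_div_succ_le_succ n
    have hα : 0 < 1 / ((n : ℝ) + 1) := by positivity
    set α := 1 / ((n : ℝ) + 1)
    set β := (n : ℝ) + 1
    have hαβ : α ≤ β := hα1.trans hβ1
    have hi1 : IntervalIntegrable (fun x => deriv F x * (1 + x ^ m)) volume α β := by
      rw [intervalIntegrable_iff_integrableOn_Ioc_of_le hαβ]
      simp_rw [mul_comm (deriv F _)]
      exact hFi.mono_set fun x hx => hα.trans hx.1
    have hi2 := intervalIntegrable_weight_deriv (m := m) hF.ac hα hαβ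
    have hi3 : IntervalIntegrable (fun x => (1 + x ^ m) * f x) volume α β := by
      rw [intervalIntegrable_iff_integrableOn_Ioc_of_le hαβ]
      exact hfi.mono_set fun x hx => hα.trans hx.1
    have e1 := integral_deriv_weight (m := m) hF.ac hα hαβ
    rw [intervalIntegral.integral_add hi1 hi2] at e1
    have e2 : ∫ x in α..β, F x * (m * x ^ (m - 1)) ≤
        K * ∫ x in α..β, (1 + x ^ m) * f x := by
      rw [← intervalIntegral.integral_const_mul]
      refine intervalIntegral.integral_mono_ae_restrict hαβ hi2 (hi3.const_mul K) ?_
      have hsub : Icc α β ⊆ Ioi 0 := fun x hx => lt_of_lt_of_le hα hx.1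
      filter_upwards [ae_restrict_of_ae_restrict_of_subset hsub hF.eq,
        ae_restrict_of_ae_restrict_of_subset hsub hf', ae_restrict_mem measurableSet_Icc]
        with x e1 e2 hx
      rw [e1]
      have := mul_le_mul_of_nonneg_right (h.growth_weight_le hm (hsub hx)) e2
      linarith
    have e3 := mul_nonneg (hFpos β (hα.trans_le hαβ)) (weight_pos m (hα.trans_le hαβ)).le
    simp_rw [mul_comm (1 + (_ : ℝ) ^ m) (deriv F _)]
    linarith
  rw [massL_apply, massL_apply, integral_weightMeasure m f]
  have e1 : ∫ x, transportOp m r q ⟨f, hfd⟩ x ∂weightMeasure m =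
      ∫ x, (-deriv F x - q x * f x) ∂weightMeasure m := by
    refine integral_congr_ae ?_
    rw [EventuallyEq, ae_weightMeasure]
    exact transportOp_coeFn hF hfd
  rw [e1, integral_sub (f := fun x => -deriv F x)
    (memLp_one_iff_integrable.1 hF.memLp_deriv).neg (memLp_one_iff_integrable.1 hF.memLp_mul), integral_neg, integral_weightMeasure m (deriv F)]
  linarith

end TransportCoeff

end GrowthFrag

/-! ### Solving the resolvent equation of the transport operator. -/

namespace GrowthFrag

namespace TransportCoeff

variable {m : ℝ} {r q : ℝ → ℝ} {r₀ r₁ : ℝ}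

/-- Pointwise form of the resolvent of the transport operator: the solution `F` of
`F' + (s + q) F / r = g` that vanishes at `0`. -/
theorem exists_primitive (h : TransportCoeff r q r₀ r₁) {s : ℝ} (hs : 0 ≤ s) {g : ℝ → ℝ}
    (hg : IntegrableOn g (Ioi 0)) (hg0 : ∀ᵐ x ∂halfLine, 0 ≤ g x) :
    ∃ F : ℝ → ℝ, ACLoc F ∧ (∀ x, 0 < x → 0 ≤ F x) ∧
      (∀ x, 0 < x → F x ≤ ∫ t in (0 : ℝ)..x, g t) ∧
      ∀ᵐ x ∂halfLine, deriv F x = g x - (s + q x) / r x * F x := by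
  set Φ : ℝ → ℝ := fun x => ∫ t in (1 : ℝ)..x, (s + q t) / r t with hΦ
  have hΦac : ACLoc Φ := (h.locInt s).acLoc
  have hΦmono : ∀ {x y : ℝ}, 0 < x → x ≤ y → Φ x ≤ Φ y := fun hx hxy =>
    (h.locInt s).primitive_mono (h.coeff_nonneg hs) hx hxy
  have hgi : ∀ β : ℝ, 0 < β → IntervalIntegrable g volume 0 β := fun β hβ => by
    rw [intervalIntegrable_iff_integrableOn_Ioc_of_le hβ.le]
    exact hg.mono_set Ioc_subset_Ioi_self
  -- `Φ` may tend to `-∞` at `0`, but it is monotone, so `exp Φ` is bounded by its value at `β`.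
  have hEg : ∀ β : ℝ, 0 < β →
      IntervalIntegrable (fun t => Real.exp (Φ t) * g t) volume 0 β := by
    intro β hβ
    rw [intervalIntegrable_iff_integrableOn_Ioc_of_le hβ.le]
    refine Integrable.bdd_mul (c := Real.exp (Φ β)) (hg.mono_set Ioc_subset_Ioi_self) ?_ ?_
    · exact (hΦac.exp.continuousOn.mono Ioc_subset_Ioi_self).aestronglyMeasurable
        measurableSet_Ioc
    · filter_upwards [ae_restrict_mem measurableSet_Ioc] with t ht
      rw [Real.norm_of_nonneg (Real.exp_nonneg _)]
      exact Real.exp_le_exp.2 (hΦmono ht.1 ht.2)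
  set G : ℝ → ℝ := fun x => ∫ t in (0 : ℝ)..x, Real.exp (Φ t) * g t with hG
  have hGac : ACLoc G := by
    intro α β hα hαβ
    have hβ := hα.trans_le hαβ
    refine ((hEg β hβ).absolutelyContinuousOnInterval_intervalIntegral
      (c := 0) (by simp)).mono ?_
    rw [uIcc_of_le hαβ, uIcc_of_le hβ.le]
    exact Icc_subset_Icc_left hα.le
  have hGd : ∀ᵐ x ∂halfLine, HasDerivAt G (Real.exp (Φ x) * g x) x := by
    refine ae_halfLine_of_forall_interval fun α β hα hα1 hβ1 => ?_
    have hβ : 0 < β := one_pos.trans_le hβ1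
    have h1 := (hEg β hβ).ae_hasDerivAt_integral
    rw [uIcc_of_le hβ.le] at h1
    filter_upwards [h1] with x hx hx'
    exact hx ⟨hα.le.trans hx'.1, hx'.2⟩ 0 ⟨le_rfl, hβ.le⟩
  have hGnonneg : ∀ x, 0 < x → 0 ≤ G x := by
    intro x hx
    rw [hG]
    simp only
    rw [intervalIntegral.integral_of_le hx.le]
    refine setIntegral_nonneg_of_ae_restrict ?_
    filter_upwards [ae_coeff_mono hg0 le_rfl] with t ht
    exact mul_nonneg (Real.exp_nonneg _) ht
  have hGle : ∀ x, 0 < x → G x ≤ Real.exp (Φ x) * ∫ t in (0 : ℝ)..x, g t := by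
    intro x hx
    rw [← intervalIntegral.integral_const_mul]
    refine intervalIntegral.integral_mono_ae_restrict hx.le (hEg x hx)
      ((hgi x hx).const_mul _) ?_
    rw [← Measure.restrict_congr_set (Ioc_ae_eq_Icc (μ := volume) (a := 0) (b := x))]
    filter_upwards [ae_coeff_mono hg0 le_rfl, ae_restrict_mem measurableSet_Ioc] with t ht ht'
    exact mul_le_mul_of_nonneg_right (Real.exp_le_exp.2 (hΦmono ht'.1 ht'.2)) ht
  refine ⟨fun x => Real.exp (-Φ x) * G x, hΦac.neg.exp.mul hGac, fun x hx => ?_, fun x hx => ?_,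
    ?_⟩
  · exact mul_nonneg (Real.exp_nonneg _) (hGnonneg x hx)
  · calc Real.exp (-Φ x) * G x
        ≤ Real.exp (-Φ x) * (Real.exp (Φ x) * ∫ t in (0 : ℝ)..x, g t) := by
          gcongr
          exact hGle x hx
      _ = ∫ t in (0 : ℝ)..x, g t := by
          rw [← mul_assoc, ← Real.exp_add]
          simp
  · filter_upwards [hGd, (h.locInt s).ae_hasDerivAt] with x h1 h2
    have h3 : HasDerivAt (fun x => -Φ x) (-((s + q x) / r x)) x := h2.neg
    refine (h3.exp.mul h1).deriv.trans ?_
    rw [← mul_assoc (Real.exp (-Φ x)), ← Real.exp_add, neg_add_cancel, Real.exp_zero]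
    ring

/-- `s - T` is onto, with positive solutions for positive data, for large `s`. -/
theorem exists_solution (h : TransportCoeff r q r₀ r₁) (hm : 1 < m) {s : ℝ}
    (hs : m * (r₀ + r₁) + 1 ≤ s) (g : X m) (hg : 0 ≤ g) :
    ∃ f : (transportOp m r q).domain, 0 ≤ (f : X m) ∧
      s • (f : X m) - transportOp m r q f = g := by
  have hK : 0 ≤ m * (r₀ + r₁) :=
    mul_nonneg (by linarith) (add_nonneg h.r₀_nonneg h.r₁_nonneg)
  have hg0 : ∀ᵐ x ∂halfLine, 0 ≤ g x := by
    rw [← ae_weightMeasure m]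
    exact (Lp.coeFn_nonneg g).2 hg
  have hgi : IntegrableOn g (Ioi 0) := integrableOn_of_memLp (Lp.memLp g)
  have hgw : IntegrableOn (fun x => (1 + x ^ m) * g x) (Ioi 0) :=
    memLp_weightMeasure_iff.1 (Lp.memLp g)
  obtain ⟨F, hFac, hF0, hFle, hFd⟩ := h.exists_primitive (by linarith : 0 ≤ s) hgi hg0
  -- With `f = F / r`, this function is `(1 + q) f w`: its integrability controls `f` and `q f` in
  -- the weighted norm at once.
  have hloc : LocInt fun x => (1 + q x) / r x * (F x * (1 + x ^ m)) := by
    intro α β hα hαβ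
    refine (h.locInt 1 α β hα hαβ).mul_continuousOn ?_
    rw [uIcc_of_le hαβ]
    exact (hFac.mul (acLoc_weight m)).continuousOn.mono fun x hx => lt_of_lt_of_le hα hx.1
  have hnonneg : ∀ᵐ x ∂halfLine, 0 ≤ (1 + q x) / r x * (F x * (1 + x ^ m)) := by
    filter_upwards [h.coeff_nonneg zero_le_one, ae_restrict_mem measurableSet_Ioi] with x h1 hx
    exact mul_nonneg h1 (mul_nonneg (hF0 x hx) (weight_pos m hx).le)
  have hint : IntegrableOn (fun x => (1 + q x) / r x * (F x * (1 + x ^ m))) (Ioi 0) := by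
    refine integrableOn_halfLine_of_bounded hnonneg hloc
      (I := (∫ x in Ioi 0, (1 + x ^ m) * g x) + (∫ x in Ioi 0, g x) * 2) ?_
    intro α β hα hα1 hβ1
    have hαβ : α ≤ β := hα1.trans hβ1
    have hsub : Icc α β ⊆ Ioi 0 := fun x hx => lt_of_lt_of_le hα hx.1
    have hsub' : Ioc α β ⊆ Ioi 0 := fun x hx => hα.trans hx.1
    have hi1 : IntervalIntegrable (fun x => (1 + x ^ m) * g x) volume α β := by
      rw [intervalIntegrable_iff_integrableOn_Ioc_of_le hαβ]
      exact hgw.mono_set hsub'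
    have hi2 : IntervalIntegrable
        (fun x => deriv F x * (1 + x ^ m) + F x * (m * x ^ (m - 1))) volume α β := by
      refine IntervalIntegrable.add ?_ (intervalIntegrable_weight_deriv hFac hα hαβ)
      refine (hFac α β hα hαβ).intervalIntegrable_deriv.mul_continuousOn ?_
      exact (acLoc_weight m α β hα hαβ).continuousOn
    have e1 := integral_deriv_weight (m := m) hFac hα hαβ
    -- `(F w)' = w g - (s + q) f w + F w'`, and `F w' ≤ K f w`. The assumption `s ≥ K + 1` leaves at
    -- least `(1 + q) f w` of the loss.
    have e2 : ∫ x in α..β, (deriv F x * (1 + x ^ m) + F x * (m * x ^ (m - 1))) ≤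
        ∫ x in α..β, ((1 + x ^ m) * g x - (1 + q x) / r x * (F x * (1 + x ^ m))) := by
      refine intervalIntegral.integral_mono_ae_restrict hαβ hi2 (hi1.sub (hloc α β hα hαβ)) ?_
      filter_upwards [ae_restrict_of_ae_restrict_of_subset hsub hFd,
        ae_restrict_mem measurableSet_Icc] with x e hx
      have hx0 : 0 < x := hsub hx
      have hr := (h.r_bound x hx0).1
      have hFr : 0 ≤ F x / r x := div_nonneg (hF0 x hx0) hr.le
      have h1 := mul_le_mul_of_nonneg_left (h.growth_weight_le hm hx0) hFr
      have h2 : F x / r x * (r x * (m * x ^ (m - 1))) = F x * (m * x ^ (m - 1)) := by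
        rw [← mul_assoc, div_mul_cancel₀ _ hr.ne']
      rw [h2] at h1
      have h3 := mul_nonneg (sub_nonneg.2 hs) (mul_nonneg hFr (weight_pos m hx0).le)
      rw [e]
      have h4 : (g x - (s + q x) / r x * F x) * (1 + x ^ m) =
          (1 + x ^ m) * g x - (s + q x) * (F x / r x * (1 + x ^ m)) := by ring
      have h5 : (1 + q x) / r x * (F x * (1 + x ^ m)) =
          (1 + q x) * (F x / r x * (1 + x ^ m)) := by ring
      rw [h4, h5]
      nlinarith
    rw [intervalIntegral.integral_sub hi1 (hloc α β hα hαβ), e1] at e2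
    have e3 : ∫ x in α..β, (1 + x ^ m) * g x ≤ ∫ x in Ioi 0, (1 + x ^ m) * g x := by
      rw [intervalIntegral.integral_of_le hαβ]
      refine setIntegral_mono_set hgw ?_ (LE.le.eventuallyLE hsub')
      filter_upwards [hg0, ae_restrict_mem measurableSet_Ioi] with x h1 hx
      exact mul_nonneg (weight_pos m hx).le h1
    have e4 : F α ≤ ∫ x in Ioi 0, g x := by
      refine (hFle α hα).trans ?_
      rw [intervalIntegral.integral_of_le hα.le]
      exact setIntegral_mono_set hgi hg0 (LE.le.eventuallyLE Ioc_subset_Ioi_self)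
    -- The weight is at most `2` on `(0, 1]`.
    have e5 : F α * (1 + α ^ m) ≤ (∫ x in Ioi 0, g x) * 2 := by
      have := Real.rpow_le_one hα.le hα1 (by linarith : 0 ≤ m)
      exact mul_le_mul e4 (by linarith) (weight_pos m hα).le ((hF0 α hα).trans e4)
    have e6 := mul_nonneg (hF0 β (hα.trans_le hαβ)) (weight_pos m (hα.trans_le hαβ)).le
    linarith
  have hfm : AEStronglyMeasurable (fun x => F x / r x) halfLine :=
    ((hFac.continuousOn.aestronglyMeasurable measurableSet_Ioi).aemeasurable.div
      h.r_meas).aestronglyMeasurable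
  have hwm : AEStronglyMeasurable (fun x : ℝ => 1 + x ^ m) halfLine :=
    (by fun_prop : Measurable fun x : ℝ => 1 + x ^ m).aestronglyMeasurable
  have hf : MemLp (fun x => F x / r x) 1 (weightMeasure m) := by
    rw [memLp_weightMeasure_iff]
    refine Integrable.mono' hint (hwm.mul hfm) ?_
    filter_upwards [h.q_nonneg, ae_restrict_mem measurableSet_Ioi] with x h1 hx
    have hw := weight_pos m hx
    have hFr : 0 ≤ F x / r x := div_nonneg (hF0 x hx) (h.r_bound x hx).1.le
    rw [Real.norm_of_nonneg (mul_nonneg hw.le hFr)]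
    have : (1 + q x) / r x * (F x * (1 + x ^ m)) =
        (1 + x ^ m) * (F x / r x) + q x * ((1 + x ^ m) * (F x / r x)) := by ring
    rw [this]
    linarith [mul_nonneg h1 (mul_nonneg hw.le hFr)]
  have hqf : MemLp (fun x => q x * (F x / r x)) 1 (weightMeasure m) := by
    rw [memLp_weightMeasure_iff]
    refine Integrable.mono' hint (hwm.mul (h.q_loc.1.aestronglyMeasurable.mul hfm)) ?_
    filter_upwards [h.q_nonneg, ae_restrict_mem measurableSet_Ioi] with x h1 hx
    have hw := weight_pos m hx
    have hFr : 0 ≤ F x / r x := div_nonneg (hF0 x hx) (h.r_bound x hx).1.le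
    rw [Real.norm_of_nonneg (mul_nonneg hw.le (mul_nonneg h1 hFr))]
    have : (1 + q x) / r x * (F x * (1 + x ^ m)) =
        (1 + x ^ m) * (F x / r x) + (1 + x ^ m) * (q x * (F x / r x)) := by ring
    rw [this]
    linarith [mul_nonneg hw.le hFr]
  let fL : X m := hf.toLp _
  have hfe : ∀ᵐ x ∂halfLine, fL x = F x / r x := by
    rw [← ae_weightMeasure m]
    exact hf.coeFn_toLp
  have hrep : IsTransportRep m r q fL F :=
    { ac := hFac
      eq := by
        filter_upwards [hfe, ae_restrict_mem measurableSet_Ioi] with x h1 hx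
        rw [h1, mul_div_cancel₀ _ (h.r_bound x hx).1.ne']
      memLp_deriv := by
        refine (memLp_congr_ae ?_).1 (((Lp.memLp g).sub (hf.const_mul s)).sub hqf)
        rw [EventuallyEq, ae_weightMeasure]
        filter_upwards [hFd] with x h1
        simp only [h1, Pi.sub_apply]
        ring
      memLp_mul := by
        refine (memLp_congr_ae ?_).1 hqf
        rw [EventuallyEq, ae_weightMeasure]
        filter_upwards [hfe] with x h1
        rw [h1]
      boundary := fun _ => by
        refine squeeze_zero' ?_ ?_ (tendsto_primitive_zero hgi)
        · filter_upwards [self_mem_nhdsWithin] with x hx using hF0 x hx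
        · filter_upwards [self_mem_nhdsWithin] with x hx using hFle x hx }
  refine ⟨⟨fL, F, hrep⟩, ?_, ?_⟩
  · rw [← Lp.coeFn_nonneg, EventuallyLE, ae_weightMeasure]
    filter_upwards [hfe, ae_restrict_mem measurableSet_Ioi] with x h1 hx
    rw [h1]
    exact div_nonneg (hF0 x hx) (h.r_bound x hx).1.le
  · have hd : fL ∈ (transportOp m r q).domain := ⟨F, hrep⟩
    have h1 : ∀ᵐ x ∂halfLine, (s • fL - transportOp m r q ⟨fL, hd⟩ : X m) x =
        (s • fL : X m) x - transportOp m r q ⟨fL, hd⟩ x := by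
      rw [← ae_weightMeasure m]
      exact Lp.coeFn_sub _ _
    refine Lp.ext ?_
    rw [EventuallyEq, ae_weightMeasure]
    filter_upwards [h1, coeFn_smul' s fL, transportOp_coeFn hrep hd, hFd, hfe]
      with x e1 e2 e3 e4 e5
    refine e1.trans ?_
    rw [e2, e3, e4, e5]
    ring

end TransportCoeff

end GrowthFrag

/-! ### Density of the domain of the transport operator. -/

namespace GrowthFrag

theorem locInt_const (c : ℝ) : LocInt fun _ => c := fun _ _ _ _ => intervalIntegrable_const

theorem LocInt.memLp_mul {m : ℝ} {k F : ℝ → ℝ} (hk : LocInt k) {α β : ℝ} (hα : 0 < α)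
    (hF : ContinuousOn F (Icc α β)) (hF0 : ∀ x ∉ Icc α β, F x = 0) :
    MemLp (fun x => k x * F x) 1 (weightMeasure m) := by
  rw [memLp_weightMeasure_iff]
  rcases le_or_gt α β with hαβ | hαβ
  · have h1 : IntervalIntegrable (fun x => k x * (F x * (1 + x ^ m))) volume α β := by
      refine (hk α β hα hαβ).mul_continuousOn ?_
      rw [uIcc_of_le hαβ]
      exact hF.mul ((acLoc_weight m).continuousOn.mono fun x hx => lt_of_lt_of_le hα hx.1)
    rw [intervalIntegrable_iff_integrableOn_Icc_of_le hαβ] at h1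
    refine (h1.congr_fun (g := fun x => (1 + x ^ m) * (k x * F x)) (fun x _ => by ring)
      measurableSet_Icc).of_forall_sdiff_eq_zero measurableSet_Ioi fun x hx => ?_
    rw [hF0 x hx.2]
    ring
  · have h1 : (fun x => (1 + x ^ m) * (k x * F x)) = fun _ => (0 : ℝ) := by
      ext x
      rw [hF0 x (by simp [Icc_eq_empty hαβ.not_ge])]
      ring
    rw [h1]
    exact integrableOn_zero

namespace TransportCoeff

variable {m : ℝ} {r q : ℝ → ℝ} {r₀ r₁ : ℝ}

/-- `F / r` is in the domain of the transport operator if `F` is `C¹` with compact support in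
`(0, ∞)`. -/
theorem memLp_div (h : TransportCoeff r q r₀ r₁) {F : ℝ → ℝ} (hF : ContDiff ℝ 1 F) {α β : ℝ}
    (hα : 0 < α) (hF0 : ∀ x ∉ Icc α β, F x = 0) :
    ∃ hf : MemLp (fun x => F x / r x) 1 (weightMeasure m),
      hf.toLp _ ∈ (transportOp m r q).domain := by
  have h1 : MemLp (fun x => F x / r x) 1 (weightMeasure m) := by
    refine (memLp_congr_ae (ae_of_all _ fun x => ?_)).1
      (h.locInt_inv.memLp_mul hα hF.continuous.continuousOn hF0)
    ring
  have h2 : MemLp (fun x => q x * (F x / r x)) 1 (weightMeasure m) := by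
    refine (memLp_congr_ae (ae_of_all _ fun x => ?_)).1
      ((h.locInt 0).memLp_mul hα hF.continuous.continuousOn hF0)
    ring
  have hd : ∀ x ∉ Icc α β, deriv F x = 0 := by
    intro x hx
    have : F =ᶠ[𝓝 x] fun _ => 0 := by
      filter_upwards [isClosed_Icc.isOpen_compl.mem_nhds hx] with y hy using hF0 y hy
    rw [this.deriv_eq, deriv_const]
  have hfe : ∀ᵐ x ∂halfLine, (h1.toLp _ : X m) x = F x / r x := by
    rw [← ae_weightMeasure m]
    exact h1.coeFn_toLp
  refine ⟨h1, F, ?_, ?_, ?_, ?_, ?_⟩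
  · intro a b _ _
    exact hF.contDiffOn.absolutelyContinuousOnInterval
  · filter_upwards [hfe, ae_restrict_mem measurableSet_Ioi] with x e1 hx
    rw [e1, mul_div_cancel₀ _ (h.r_bound x hx).1.ne']
  · refine (memLp_congr_ae (ae_of_all _ fun x => ?_)).1
      ((locInt_const 1).memLp_mul hα (hF.continuous_deriv_one).continuousOn hd)
    ring
  · refine (memLp_congr_ae ?_).1 h2
    rw [EventuallyEq, ae_weightMeasure]
    filter_upwards [hfe] with x e1
    rw [e1]
  · intro _
    refine tendsto_const_nhds.congr' ?_
    filter_upwards [Ioo_mem_nhdsGT hα] with x hx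
    exact (hF0 x fun hx' => absurd hx'.1 (not_le.2 hx.2)).symm

/-- Smooth cut-off functions exhausting `(0, ∞)`. -/
theorem exists_cutoff : ∃ χ : ℕ → ℝ → ℝ, ∃ α β : ℕ → ℝ, (∀ n, 0 < α n) ∧
    (∀ n, ContDiff ℝ 1 (χ n)) ∧ (∀ n, ∀ x ∉ Icc (α n) (β n), χ n x = 0) ∧
    (∀ n x, 0 ≤ χ n x ∧ χ n x ≤ 1) ∧ ∀ x, 0 < x → ∀ᶠ n in atTop, χ n x = 1 := by
  have h1 : ∀ n : ℕ, 1 / ((n : ℝ) + 1) ≤ 1 := fun n => (one_div_succ_le_succ n).1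
  have h2 : ∀ n : ℕ, 0 < 1 / ((n : ℝ) + 1) := fun n => by positivity
  have h3 : ∀ n : ℕ, (0 : ℝ) ≤ n := fun n => n.cast_nonneg
  -- Centred at `n + 2`, the radii place the left ends of the plateau and of the support at `1 / (n
  -- + 1)` and `1 / (2 (n + 1))`.
  let φ : (n : ℕ) → ContDiffBump ((n : ℝ) + 2) := fun n =>
    { rIn := n + 2 - 1 / ((n : ℝ) + 1)
      rOut := n + 2 - 1 / ((n : ℝ) + 1) / 2
      rIn_pos := by linarith [h1 n, h3 n]
      rIn_lt_rOut := by linarith [h2 n] }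
  refine ⟨fun n => φ n, fun n => 1 / ((n : ℝ) + 1) / 2,
    fun n => (n + 2) + (n + 2 - 1 / ((n : ℝ) + 1) / 2), fun n => by positivity,
    fun n => (φ n).contDiff, fun n x hx => ?_, fun n x => ⟨(φ n).nonneg, (φ n).le_one⟩,
    fun x hx => ?_⟩
  · refine (φ n).zero_of_le_dist ?_
    rw [Real.dist_eq]
    change (n : ℝ) + 2 - 1 / ((n : ℝ) + 1) / 2 ≤ _
    by_contra hlt
    rw [not_le, abs_lt] at hlt
    exact hx ⟨by linarith [hlt.1], by linarith [hlt.2]⟩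
  · have e1 : ∀ᶠ n : ℕ in atTop, 1 / ((n : ℝ) + 1) < x :=
      tendsto_one_div_add_atTop_nhds_zero_nat.eventually (gt_mem_nhds hx)
    filter_upwards [e1, tendsto_natCast_atTop_atTop.eventually (eventually_ge_atTop x)]
      with n e1 e2
    refine (φ n).one_of_mem_closedBall ?_
    rw [Metric.mem_closedBall, Real.dist_eq, abs_le]
    change -((n : ℝ) + 2 - 1 / ((n : ℝ) + 1)) ≤ _ ∧ _ ≤ (n : ℝ) + 2 - 1 / ((n : ℝ) + 1)
    constructor
    · linarith
    · linarith [h1 n, h3 n]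

/-- Since `r` need not be smooth, it is `r g` rather than `g` that is approximated. After a cut-off
to a compact interval, a smooth `φ` close to `r g` in `L¹` with respect to `w / r` gives `χ φ / r`,
which is in the domain and close to `χ g` in the weighted norm. -/
theorem dense_domain (h : TransportCoeff r q r₀ r₁) :
    Dense ((transportOp m r q).domain : Set (X m)) := by
  intro g
  rw [EMetric.mem_closure_iff]
  intro ε hε
  obtain ⟨δ, -, hδε⟩ := ENNReal.lt_iff_exists_real_btwn.1 (ENNReal.half_pos hε.ne')
  have hδ0 : 0 < δ := by
    rw [← ENNReal.ofReal_pos]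
    exact hδε.1
  obtain ⟨χ, α, β, hα, hχ, hχ0, hχb, hχ1⟩ := exists_cutoff
  set μ := weightMeasure m with hμ
  have hgi : Integrable g μ := memLp_one_iff_integrable.1 (Lp.memLp g)
  have hgm : AEStronglyMeasurable g μ := hgi.aestronglyMeasurable
  obtain ⟨n, hn⟩ : ∃ n, eLpNorm (fun x => g x - χ n x * g x) 1 μ < ε / 2 := by
    have ht : Tendsto (fun n => ∫⁻ x, ‖g x - χ n x * g x‖ₑ ∂μ) atTop (𝓝 (∫⁻ _, 0 ∂μ)) := by
      refine tendsto_lintegral_of_dominated_convergence' (fun x => ‖g x‖ₑ) (fun n => ?_)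
        (fun n => ae_of_all _ fun x => ?_) hgi.hasFiniteIntegral.ne ?_
      · exact (hgm.sub ((hχ n).continuous.aestronglyMeasurable.mul hgm)).enorm
      · have e : g x - χ n x * g x = (1 - χ n x) * g x := by ring
        rw [enorm_le_iff_norm_le, e, norm_mul, Real.norm_of_nonneg (by linarith [(hχb n x).2])]
        exact mul_le_of_le_one_left (norm_nonneg _) (by linarith [(hχb n x).1])
      · have : ∀ᵐ x ∂μ, 0 < x := by
          rw [hμ, ae_weightMeasure]
          exact ae_restrict_mem measurableSet_Ioi
        filter_upwards [this] with x hx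
        refine tendsto_const_nhds.congr' ?_
        filter_upwards [hχ1 x hx] with n hn
        simp [hn]
    rw [lintegral_zero] at ht
    obtain ⟨n, hn⟩ := (ht.eventually (gt_mem_nhds (ENNReal.half_pos hε.ne'))).exists
    exact ⟨n, by rwa [eLpNorm_one_eq_lintegral_enorm]⟩
  set J := Icc (α n) (β n) with hJ
  have hJpos : ∀ x ∈ J, 0 < x := fun x hx => lt_of_lt_of_le (hα n) hx.1
  have hrm : AEMeasurable r μ := h.r_meas.mono_ac (withDensity_absolutelyContinuous _ _)
  have hrJ : AEMeasurable (fun x => ENNReal.ofReal (1 / r x)) (μ.restrict J) :=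
    (hrm.restrict.const_div 1).ennreal_ofReal
  have hinvJ : IntegrableOn (fun x => 1 / r x) J μ := by
    have h1 : MemLp (fun x => 1 / r x * J.indicator (fun _ => 1) x) 1 μ := by
      refine h.locInt_inv.memLp_mul (α := α n) (β := β n) (hα n) ?_ ?_
      · exact continuousOn_const.congr fun x hx => indicator_of_mem hx _
      · exact fun x hx => indicator_of_notMem hx _
    refine (memLp_one_iff_integrable.1 h1).integrableOn.congr_fun (fun x hx => ?_)
      measurableSet_Icc
    simp only [indicator_of_mem hx, mul_one]
  -- This measure is finite by local integrability of `1 / r`, and `r g` is `ν`-integrable because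
  -- the factor `r` cancels.
  set ν := (μ.restrict J).withDensity fun x => ENNReal.ofReal (1 / r x) with hν
  have hfin : IsFiniteMeasure ν := isFiniteMeasure_withDensity_ofReal hinvJ.hasFiniteIntegral
  have hrg : MemLp (fun x => r x * g x) 1 ν := by
    rw [memLp_one_iff_integrable, hν,
      integrable_withDensity_iff_integrable_smul₀' hrJ (by simp)]
    refine hgi.integrableOn.congr_fun (fun x hx => ?_) measurableSet_Icc
    have hr := (h.r_bound x (hJpos x hx)).1
    rw [ENNReal.toReal_ofReal (by positivity), smul_eq_mul, ← mul_assoc, one_div_mul_cancel hr.ne',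
      one_mul]
  obtain ⟨φ, -, hφ, hφε⟩ := hrg.exist_eLpNorm_sub_le ENNReal.one_ne_top le_rfl hδ0
  have hφ1 : ContDiff ℝ 1 φ := hφ.of_le (by exact_mod_cast le_top)
  obtain ⟨hf, hfd⟩ := h.memLp_div (m := m) (F := fun x => χ n x * φ x) ((hχ n).mul hφ1) (hα n)
    (fun x hx => by rw [hχ0 n x hx, zero_mul])
  refine ⟨hf.toLp _, hfd, ?_⟩
  have e1 : edist g (hf.toLp _) = eLpNorm (fun x => g x - χ n x * φ x / r x) 1 μ := by
    rw [Lp.edist_def]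
    refine eLpNorm_congr_ae ?_
    filter_upwards [hf.coeFn_toLp] with x hx
    rw [Pi.sub_apply, hx]
  have e2 : (fun x => g x - χ n x * φ x / r x) =
      (fun x => g x - χ n x * g x) + fun x => χ n x * g x - χ n x * φ x / r x := by
    ext x
    simp
  have hχg := (hχ n).continuous.aestronglyMeasurable.mul hgm
  have e3 : eLpNorm (fun x => χ n x * g x - χ n x * φ x / r x) 1 μ ≤ ENNReal.ofReal δ := by
    refine le_trans ?_ hφε
    rw [eLpNorm_one_eq_lintegral_enorm, eLpNorm_one_eq_lintegral_enorm, hν]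
    have hm1 : AEMeasurable (fun x => ‖(fun x => r x * g x) x - φ x‖ₑ) (μ.restrict J) :=
      ((hrm.mul hgm.aemeasurable).sub
        hφ.continuous.aestronglyMeasurable.aemeasurable).restrict.enorm
    refine le_of_le_of_eq ?_ (lintegral_withDensity_eq_lintegral_mul₀ hrJ hm1).symm
    rw [← lintegral_indicator measurableSet_Icc]
    refine lintegral_mono fun x => ?_
    by_cases hx : x ∈ J
    · rw [indicator_of_mem hx]
      have hr := (h.r_bound x (hJpos x hx)).1
      simp only [Pi.mul_apply]
      rw [← Real.enorm_of_nonneg (by positivity : 0 ≤ 1 / r x), ← enorm_mul,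
        enorm_le_iff_norm_le]
      have e : χ n x * g x - χ n x * φ x / r x = χ n x * (1 / r x * (r x * g x - φ x)) := by
        field_simp
      rw [e, norm_mul, Real.norm_of_nonneg (hχb n x).1]
      exact mul_le_of_le_one_left (norm_nonneg _) (hχb n x).2
    · rw [hχ0 n x hx]
      simp
  rw [e1, e2]
  calc _ ≤ _ := eLpNorm_add_le (hgm.sub hχg) (hχg.sub hf.aestronglyMeasurable) le_rfl
    _ < ε / 2 + ε / 2 := ENNReal.add_lt_add hn (e3.trans_lt hδε.2)
    _ = ε := ENNReal.add_halves ε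

end TransportCoeff

end GrowthFrag

namespace GrowthFrag

/-! ### Moments of the fragmentation kernel -/

section kernel

variable {b : ℝ → ℝ → ℝ} {m m₀ y : ℝ}

/-- Bernoulli's inequality for the exponent `κ ≤ 1`, after lowering `θ` to `κ`. -/
theorem rpow_le_one_sub_mul {u θ κ : ℝ} (hu : 0 < u) (hu1 : u ≤ 1) (hκ0 : 0 ≤ κ) (hκ1 : κ ≤ 1)
    (hκθ : κ ≤ θ) : u ^ θ ≤ 1 - κ * (1 - u) := by
  have h1 : u ^ θ ≤ u ^ κ := Real.rpow_le_rpow_of_exponent_ge hu hu1 hκθ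
  have h2 := rpow_one_add_le_one_add_mul_self (s := u - 1) (by linarith) hκ0 hκ1
  rw [add_sub_cancel] at h2
  linarith

/-- Comparison of the integrands of the moments of order `m` and `m₀`. -/
theorem rpow_le_interpolation (hm₀ : 1 < m₀) {κ : ℝ} (hκ0 : 0 ≤ κ) (hκ1 : κ ≤ 1)
    (hκ : κ ≤ (m - 1) / (m₀ - 1)) {x : ℝ} (hx : 0 < x) (hxy : x ≤ y) :
    x ^ m ≤ (1 - κ) * y ^ (m - 1) * x + κ * y ^ (m - m₀) * x ^ m₀ := by
  have hy : 0 < y := hx.trans_le hxy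
  have ht : 0 < x / y := div_pos hx hy
  have ht1 : x / y ≤ 1 := (div_le_one hy).2 hxy
  -- With this `u` and `θ = (m - 1) / (m₀ - 1)`, one has `u ^ θ = (x / y) ^ (m - 1)`.
  have h1 := rpow_le_one_sub_mul (u := (x / y) ^ (m₀ - 1)) (Real.rpow_pos_of_pos ht _)
    (Real.rpow_le_one ht.le ht1 (by linarith)) hκ0 hκ1 hκ
  rw [← Real.rpow_mul ht.le, mul_div_cancel₀ _ (by linarith : m₀ - 1 ≠ 0),
    Real.div_rpow hx.le hy.le, Real.div_rpow hx.le hy.le] at h1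
  have hy1 : 0 < y ^ (m - 1) := Real.rpow_pos_of_pos hy _
  have hy2 : 0 < y ^ (m₀ - 1) := Real.rpow_pos_of_pos hy _
  have e1 : x ^ m = x ^ (m - 1) * x := by
    rw [← Real.rpow_add_one hx.ne', sub_add_cancel]
  have e2 : x ^ m₀ = x ^ (m₀ - 1) * x := by
    rw [← Real.rpow_add_one hx.ne', sub_add_cancel]
  have e3 : y ^ (m - m₀) = y ^ (m - 1) / y ^ (m₀ - 1) := by
    rw [← Real.rpow_sub hy]
    congr 1
    ring
  have h2 : x ^ (m - 1) ≤ y ^ (m - 1) * (1 - κ * (1 - x ^ (m₀ - 1) / y ^ (m₀ - 1))) := by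
    have := mul_le_mul_of_nonneg_left h1 hy1.le
    rwa [mul_div_cancel₀ _ hy1.ne'] at this
  calc x ^ m = x ^ (m - 1) * x := e1
    _ ≤ y ^ (m - 1) * (1 - κ * (1 - x ^ (m₀ - 1) / y ^ (m₀ - 1))) * x := by gcongr
    _ = _ := by
      rw [e2, e3]
      ring

/-- Conservation of mass and `x ^ m ≤ y ^ (m - 1) x`. In particular higher moments are finite, so
`toReal` in `momentDefect` loses nothing. -/
theorem kernelMoment_le (hb : ∀ x, 0 < x → 0 ≤ b x y) (hmass : kernelMoment b 1 y = ENNReal.ofReal y)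
    (hm : 1 < m) (hy : 0 < y) : kernelMoment b m y ≤ ENNReal.ofReal (y ^ m) := by
  have h1 : kernelMoment b m y ≤ ENNReal.ofReal (y ^ (m - 1)) * kernelMoment b 1 y := by
    rw [kernelMoment, kernelMoment, ← lintegral_const_mul' _ _ ENNReal.ofReal_ne_top]
    refine setLIntegral_mono' measurableSet_Ioc fun x hx => ?_
    rw [← ENNReal.ofReal_mul (Real.rpow_nonneg hy.le _)]
    refine ENNReal.ofReal_le_ofReal ?_
    have e1 : x ^ m = x ^ (m - 1) * x := by
      rw [← Real.rpow_add_one hx.1.ne', sub_add_cancel]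
    have h2 : x ^ (m - 1) ≤ y ^ (m - 1) := Real.rpow_le_rpow hx.1.le hx.2 (by linarith)
    rw [e1, Real.rpow_one]
    have h3 := mul_le_mul_of_nonneg_right h2 (mul_nonneg (hb x hx.1) hx.1.le)
    linarith
  refine h1.trans_eq ?_
  rw [hmass, ← ENNReal.ofReal_mul (Real.rpow_nonneg hy.le _), ← Real.rpow_add_one hy.ne',
    sub_add_cancel]

/-- Transfers the defect from the exponent `m₀` to `m`, by integrating the interpolation inequality:
`(1 - κ) y ^ m` comes from the first moment and `κ (1 - c) y ^ m` from the moment of order `m₀`. -/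
theorem kernelMoment_le_of_momentDefect (hb : ∀ x, 0 < x → 0 ≤ b x y)
    (hbm : AEMeasurable (fun x => b x y) (volume.restrict (Ioc 0 y)))
    (hmass : kernelMoment b 1 y = ENNReal.ofReal y) (hm₀ : 1 < m₀) (hy : 0 < y)
    {κ c : ℝ} (hκ0 : 0 ≤ κ) (hκ1 : κ ≤ 1) (hκ : κ ≤ (m - 1) / (m₀ - 1))
    (hc : c * y ^ m₀ ≤ momentDefect b m₀ y) :
    kernelMoment b m y ≤ ENNReal.ofReal ((1 - κ * c) * y ^ m) := by
  have hfin : kernelMoment b m₀ y ≠ ∞ :=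
    ((kernelMoment_le hb hmass hm₀ hy).trans_lt ENNReal.ofReal_lt_top).ne
  have hA : 0 ≤ (1 - κ) * y ^ (m - 1) :=
    mul_nonneg (by linarith) (Real.rpow_nonneg hy.le _)
  have hB : 0 ≤ κ * y ^ (m - m₀) := mul_nonneg hκ0 (Real.rpow_nonneg hy.le _)
  have h1 : kernelMoment b m y ≤ ENNReal.ofReal ((1 - κ) * y ^ (m - 1)) * kernelMoment b 1 y +
      ENNReal.ofReal (κ * y ^ (m - m₀)) * kernelMoment b m₀ y := by
    rw [kernelMoment, kernelMoment, kernelMoment,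
      ← lintegral_const_mul' _ _ ENNReal.ofReal_ne_top,
      ← lintegral_const_mul' _ _ ENNReal.ofReal_ne_top, ← lintegral_add_left']
    · refine setLIntegral_mono' measurableSet_Ioc fun x hx => ?_
      have hbx := hb x hx.1
      have hxp := Real.rpow_nonneg hx.1.le m₀
      rw [Real.rpow_one, ← ENNReal.ofReal_mul hA, ← ENNReal.ofReal_mul hB,
        ← ENNReal.ofReal_add (mul_nonneg hA (mul_nonneg hbx hx.1.le))
          (mul_nonneg hB (mul_nonneg hbx hxp))]
      refine ENNReal.ofReal_le_ofReal ?_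
      have := mul_le_mul_of_nonneg_left (rpow_le_interpolation hm₀ hκ0 hκ1 hκ hx.1 hx.2) hbx
      linarith
    · exact (hbm.mul (by fun_prop)).ennreal_ofReal.const_mul _
  refine h1.trans ?_
  rw [hmass, ← ENNReal.ofReal_toReal hfin, ← ENNReal.ofReal_mul hA, ← ENNReal.ofReal_mul hB,
    ← ENNReal.ofReal_add (mul_nonneg hA hy.le) (mul_nonneg hB ENNReal.toReal_nonneg)]
  refine ENNReal.ofReal_le_ofReal ?_
  rw [momentDefect] at hc
  have h2 : (kernelMoment b m₀ y).toReal ≤ (1 - c) * y ^ m₀ := by linarith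
  have e1 : y ^ (m - 1) * y = y ^ m := by rw [← Real.rpow_add_one hy.ne', sub_add_cancel]
  have e2 : y ^ (m - m₀) * y ^ m₀ = y ^ m := by rw [← Real.rpow_add hy, sub_add_cancel]
  calc _ ≤ (1 - κ) * y ^ (m - 1) * y + κ * y ^ (m - m₀) * ((1 - c) * y ^ m₀) := by gcongr
    _ = (1 - κ) * (y ^ (m - 1) * y) + κ * (1 - c) * (y ^ (m - m₀) * y ^ m₀) := by ring
    _ = _ := by
      rw [e1, e2]
      ring

/-- A positive lower bound at infinity for the relative moment defect. -/
theorem exists_momentDefect_bound (hb : ∀ x y, 0 < x → 0 < y → 0 ≤ b x y)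
    (hmass : ∀ y, 0 < y → kernelMoment b 1 y = ENNReal.ofReal y) (hm₀ : 1 < m₀)
    (hN : 0 < liminf (fun y => momentDefect b m₀ y / y ^ m₀) atTop) :
    ∃ c : ℝ, 0 < c ∧ c < 1 ∧ ∀ᶠ y in atTop, c * y ^ m₀ ≤ momentDefect b m₀ y := by
  -- A real-valued `liminf` yields eventual lower bounds only for functions bounded below; here the
  -- defect is nonnegative.
  have hbdd : IsBoundedUnder (· ≥ ·) atTop fun y => momentDefect b m₀ y / y ^ m₀ := by
    refine ⟨0, eventually_map.2 ?_⟩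
    filter_upwards [eventually_gt_atTop 0] with y hy
    have h1 := kernelMoment_le (fun x hx => hb x y hx hy) (hmass y hy) hm₀ hy
    have h2 := ENNReal.toReal_le_of_le_ofReal (Real.rpow_nonneg hy.le _) h1
    exact div_nonneg (sub_nonneg.2 h2) (Real.rpow_nonneg hy.le _)
  obtain ⟨c, hc0, hc⟩ := exists_between hN
  have hev := eventually_lt_of_lt_liminf hc hbdd
  have hev' : ∀ᶠ y in atTop, c * y ^ m₀ ≤ momentDefect b m₀ y := by
    filter_upwards [hev, eventually_gt_atTop 0] with y h1 hy
    exact ((lt_div_iff₀ (Real.rpow_pos_of_pos hy _)).1 h1).le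
  refine ⟨c, hc0, ?_, hev'⟩
  obtain ⟨y, h1, hy⟩ := (hev.and (eventually_gt_atTop 0)).exists
  refine h1.trans_le ((div_le_one (Real.rpow_pos_of_pos hy _)).2 ?_)
  rw [momentDefect]
  linarith [ENNReal.toReal_nonneg (a := kernelMoment b m₀ y)]

/-- `∫₀^y b(x, y) (1 + x ^ m) dx`. -/
noncomputable def kernelWeight (b : ℝ → ℝ → ℝ) (m y : ℝ) : ℝ≥0∞ :=
  ∫⁻ x in Ioc 0 y, ENNReal.ofReal (b x y * (1 + x ^ m))

theorem kernelWeight_le (hb : ∀ x, 0 < x → 0 ≤ b x y)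
    (hbm : AEMeasurable (fun x => b x y) (volume.restrict (Ioc 0 y))) :
    kernelWeight b m y ≤ kernelMoment b 0 y + kernelMoment b m y := by
  rw [kernelWeight, kernelMoment, kernelMoment, ← lintegral_add_left']
  · refine setLIntegral_mono' measurableSet_Ioc fun x hx => ?_
    rw [Real.rpow_zero, ← ENNReal.ofReal_add (mul_nonneg (hb x hx.1) zero_le_one)
      (mul_nonneg (hb x hx.1) (Real.rpow_nonneg hx.1.le _)), ← mul_add]
  · exact (hbm.mul (by fun_prop)).ennreal_ofReal

theorem eventually_rpow_le {b₀ l δ : ℝ} (hl : 0 ≤ l) (hlm : l < m) (hδ : 0 < δ) :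
    ∀ᶠ y : ℝ in atTop, b₀ * (1 + y ^ l) ≤ δ * y ^ m := by
  have h1 : Tendsto (fun y : ℝ => b₀ * (y ^ (-m) + y ^ (-(m - l)))) atTop (𝓝 0) := by
    simpa using ((tendsto_rpow_neg_atTop (by linarith : 0 < m)).add
      (tendsto_rpow_neg_atTop (by linarith : 0 < m - l))).const_mul b₀
  filter_upwards [h1.eventually (gt_mem_nhds hδ), eventually_gt_atTop 0] with y h2 hy
  have hm : 0 < y ^ m := Real.rpow_pos_of_pos hy m
  have h3 := mul_le_mul_of_nonneg_right h2.le hm.le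
  have e1 : y ^ (-m) * y ^ m = 1 := by
    rw [← Real.rpow_add hy]
    simp
  have e2 : y ^ (-(m - l)) * y ^ m = y ^ l := by
    rw [← Real.rpow_add hy]
    congr 1
    ring
  calc b₀ * (1 + y ^ l) = b₀ * (y ^ (-m) * y ^ m + y ^ (-(m - l)) * y ^ m) := by rw [e1, e2]
    _ = b₀ * (y ^ (-m) + y ^ (-(m - l))) * y ^ m := by ring
    _ ≤ _ := h3

/-- Joint almost everywhere measurability controls only almost every section, which is why the
bounds on `kernelWeight` hold for almost every `y`. -/
theorem ae_aemeasurable_section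
    (hb : AEMeasurable (Function.uncurry b) (halfLine.prod halfLine)) :
    ∀ᵐ y ∂halfLine, AEMeasurable (fun x => b x y) (volume.restrict (Ioc 0 y)) := by
  have h1 : SFinite halfLine := by
    rw [halfLine]
    infer_instance
  filter_upwards [hb.aestronglyMeasurable.prodMk_right] with y hy
  exact hy.aemeasurable.mono_measure (Measure.restrict_mono Ioc_subset_Ioi_self le_rfl)

/-- Bounds for `∫₀^y b(x, y) (1 + x ^ m) dx` by the weight `1 + y ^ m`: globally with some constant,
and near infinity with a constant less than one. -/
theorem exists_kernelWeight_bounds {b₀ l : ℝ}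
    (hb_meas : AEMeasurable (Function.uncurry b) (halfLine.prod halfLine))
    (hb : ∀ x y, 0 < x → 0 < y → 0 ≤ b x y)
    (hmass : ∀ y, 0 < y → kernelMoment b 1 y = ENNReal.ofReal y)
    (hb₀ : 0 < b₀) (hl : 0 ≤ l)
    (hn₀ : ∀ y, 0 < y → kernelMoment b 0 y ≤ ENNReal.ofReal (b₀ * (1 + y ^ l)))
    (hm₀ : 1 < m₀) (hN : 0 < liminf (fun y => momentDefect b m₀ y / y ^ m₀) atTop)
    (hm : 1 < m) (hlm : l < m) :
    (∀ᵐ y ∂halfLine, kernelWeight b m y ≤ ENNReal.ofReal ((2 * b₀ + 1) * (1 + y ^ m))) ∧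
      ∃ η ρ : ℝ, 0 < η ∧ η < 1 ∧
        ∀ᵐ y ∂halfLine, ρ ≤ y → kernelWeight b m y ≤ ENNReal.ofReal (η * (1 + y ^ m)) := by
  have hsec := ae_aemeasurable_section hb_meas
  constructor
  · filter_upwards [hsec, ae_restrict_mem measurableSet_Ioi] with y h1 hy
    have hy : 0 < y := hy
    have hyl := Real.rpow_nonneg hy.le l
    have hym := Real.rpow_nonneg hy.le m
    refine (kernelWeight_le (fun x hx => hb x y hx hy) h1).trans ?_
    refine (add_le_add (hn₀ y hy) (kernelMoment_le (fun x hx => hb x y hx hy)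
      (hmass y hy) hm hy)).trans ?_
    rw [← ENNReal.ofReal_add (by positivity) hym]
    refine ENNReal.ofReal_le_ofReal ?_
    have h2 : y ^ l ≤ 1 + y ^ m := by
      rcases le_total y 1 with hy1 | hy1
      · linarith [Real.rpow_le_one hy.le hy1 hl]
      · linarith [Real.rpow_le_rpow_of_exponent_le hy1 hlm.le]
    nlinarith [mul_le_mul_of_nonneg_left h2 hb₀.le, mul_nonneg hb₀.le hym]
  · obtain ⟨c, hc0, hc1, hc⟩ := exists_momentDefect_bound hb hmass hm₀ hN
    set κ := min 1 ((m - 1) / (m₀ - 1)) with hκ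
    have hκ0 : 0 < κ := lt_min one_pos (div_pos (by linarith) (by linarith))
    have hκ1 : κ ≤ 1 := min_le_left _ _
    have hκc : 0 < κ * c := mul_pos hκ0 hc0
    have hκc1 : κ * c < 1 := by nlinarith
    obtain ⟨ρ, hρ⟩ := eventually_atTop.1 (hc.and
      (eventually_rpow_le (b₀ := b₀) hl hlm (half_pos hκc)))
    -- Half of the gain `κ c` in the moment of order `m` absorbs the number of particles, which is
    -- of lower order as `l < m`.
    refine ⟨1 - κ * c / 2, ρ, by linarith, by linarith, ?_⟩
    filter_upwards [hsec, ae_restrict_mem measurableSet_Ioi] with y h1 hy hρy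
    have hy : 0 < y := hy
    have hyl := Real.rpow_nonneg hy.le l
    have hym := Real.rpow_nonneg hy.le m
    obtain ⟨h2, h3⟩ := hρ y hρy
    refine (kernelWeight_le (fun x hx => hb x y hx hy) h1).trans ?_
    refine (add_le_add (hn₀ y hy) (kernelMoment_le_of_momentDefect (fun x hx => hb x y hx hy) h1
      (hmass y hy) hm₀ hy hκ0.le hκ1 (min_le_right _ _) h2)).trans ?_
    rw [← ENNReal.ofReal_add (by positivity) (mul_nonneg (by linarith) hym)]
    refine ENNReal.ofReal_le_ofReal ?_
    linarith

end kernel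

end GrowthFrag

namespace GrowthFrag

/-! ### The gain operator -/

instance : SFinite halfLine := by
  rw [halfLine]
  infer_instance

instance (m : ℝ) : SFinite (weightMeasure m) := by
  rw [weightMeasure]
  infer_instance

/-- The integrand of the gain operator, on the product space. -/
noncomputable def gainKernel (a : ℝ → ℝ) (b : ℝ → ℝ → ℝ) (f : ℝ → ℝ) : ℝ × ℝ → ℝ :=
  {p : ℝ × ℝ | p.1 < p.2}.indicator fun p => a p.2 * b p.1 p.2 * f p.2

section gainOp

variable {m : ℝ} {a : ℝ → ℝ} {b : ℝ → ℝ → ℝ} {f : X m}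

theorem gainKernel_section (f : ℝ → ℝ) (x : ℝ) :
    (fun y => gainKernel a b f (x, y)) = (Ioi x).indicator fun y => a y * b x y * f y := by
  ext y
  by_cases h : x < y
  · rw [gainKernel, indicator_of_mem (show (x, y) ∈ {p : ℝ × ℝ | p.1 < p.2} from h),
      indicator_of_mem (show y ∈ Ioi x from h)]
  · rw [gainKernel, indicator_of_notMem (show (x, y) ∉ {p : ℝ × ℝ | p.1 < p.2} from h),
      indicator_of_notMem (show y ∉ Ioi x from h)]

theorem halfLine_restrict_Ioi {x : ℝ} (hx : 0 < x) :
    halfLine.restrict (Ioi x) = volume.restrict (Ioi x) := by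
  rw [halfLine, Measure.restrict_restrict measurableSet_Ioi,
    inter_eq_left.2 (Ioi_subset_Ioi hx.le)]

theorem integral_gainKernel (f : ℝ → ℝ) {x : ℝ} (hx : 0 < x) :
    ∫ y, gainKernel a b f (x, y) ∂halfLine = gain a b f x := by
  rw [gainKernel_section, integral_indicator measurableSet_Ioi, halfLine_restrict_Ioi hx, gain]

theorem aestronglyMeasurable_gainKernel (ha : AEMeasurable a halfLine)
    (hb_meas : AEMeasurable (Function.uncurry b) (halfLine.prod halfLine)) (f : X m) :
    AEStronglyMeasurable (gainKernel a b f) ((weightMeasure m).prod halfLine) := by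
  have hac : weightMeasure m ≪ halfLine := withDensity_absolutelyContinuous _ _
  have h1 : AEMeasurable (Function.uncurry b) ((weightMeasure m).prod halfLine) :=
    hb_meas.mono_ac (hac.prod Measure.AbsolutelyContinuous.rfl)
  have h2 : AEMeasurable (fun p : ℝ × ℝ => a p.2) ((weightMeasure m).prod halfLine) :=
    ha.comp_snd
  have hf : AEMeasurable f halfLine :=
    (Lp.memLp f).aestronglyMeasurable.aemeasurable.mono_measure (halfLine_le_weightMeasure m)
  have h3 : AEMeasurable (fun p : ℝ × ℝ => f p.2) ((weightMeasure m).prod halfLine) :=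
    hf.comp_snd
  exact ((h2.mul h1).mul h3).aestronglyMeasurable.indicator
    (measurableSet_lt measurable_fst measurable_snd)

/-- Tonelli: integrating first in `x` puts the weight on the kernel. -/
theorem lintegral_gainKernel_le (ha : AEMeasurable a halfLine)
    (hb_meas : AEMeasurable (Function.uncurry b) (halfLine.prod halfLine))
    (hb : ∀ x y, 0 < x → 0 < y → 0 ≤ b x y) (f : X m) :
    ∫⁻ p, ‖gainKernel a b f p‖ₑ ∂((weightMeasure m).prod halfLine) ≤
      ∫⁻ y, ‖a y * f y‖ₑ * kernelWeight b m y ∂halfLine := by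
  rw [lintegral_prod_symm _ (aestronglyMeasurable_gainKernel ha hb_meas f).enorm]
  refine lintegral_mono_ae ?_
  filter_upwards [ae_restrict_mem measurableSet_Ioi] with y hy
  have hy : 0 < y := hy
  rw [kernelWeight, ← lintegral_const_mul' _ _ enorm_ne_top]
  -- The one-sided form needs no measurability of the sections in `x`.
  refine (lintegral_withDensity_le_lintegral_mul _ (measurable_weight m) _).trans ?_
  rw [halfLine, ← lintegral_indicator measurableSet_Ioc, ← lintegral_indicator measurableSet_Ioi]
  refine lintegral_mono fun x => ?_
  by_cases hx : 0 < x
  · rw [indicator_of_mem (show x ∈ Ioi 0 from hx)]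
    by_cases hxy : x < y
    · rw [indicator_of_mem (show x ∈ Ioc 0 y from ⟨hx, hxy.le⟩)]
      have hb' := hb x y hx hy
      have hw := (weight_pos m hx).le
      simp only [Pi.mul_apply]
      rw [gainKernel, indicator_of_mem (show (x, y) ∈ {p : ℝ × ℝ | p.1 < p.2} from hxy),
        ← Real.enorm_of_nonneg hw, ← Real.enorm_of_nonneg (mul_nonneg hb' hw), ← enorm_mul,
        ← enorm_mul]
      refine le_of_eq (congrArg _ ?_)
      ring
    · simp only [Pi.mul_apply]
      rw [gainKernel, indicator_of_notMem (show (x, y) ∉ {p : ℝ × ℝ | p.1 < p.2} from hxy)]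
      simp
  · rw [indicator_of_notMem (show x ∉ Ioi 0 from hx)]
    exact zero_le

/-- A criterion for membership in the domain of the gain operator, with a bound for the mass. -/
theorem inGainDomain_of_le (ha : AEMeasurable a halfLine)
    (hb_meas : AEMeasurable (Function.uncurry b) (halfLine.prod halfLine))
    (hb : ∀ x y, 0 < x → 0 < y → 0 ≤ b x y) {D : ℝ → ℝ} (hD : IntegrableOn D (Ioi 0))
    (hD0 : ∀ᵐ y ∂halfLine, 0 ≤ D y)
    (hle : ∀ᵐ y ∂halfLine, ‖a y * f y‖ₑ * kernelWeight b m y ≤ ENNReal.ofReal (D y)) :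
    InGainDomain m a b f ∧ ∫ x, gain a b f x ∂weightMeasure m ≤ ∫ y in Ioi 0, D y := by
  have hbound : ∫⁻ p, ‖gainKernel a b f p‖ₑ ∂((weightMeasure m).prod halfLine) ≤
      ENNReal.ofReal (∫ y in Ioi 0, D y) := by
    refine (lintegral_gainKernel_le ha hb_meas hb f).trans ((lintegral_mono_ae hle).trans_eq ?_)
    exact (ofReal_integral_eq_lintegral_ofReal hD hD0).symm
  have hint : Integrable (gainKernel a b f) ((weightMeasure m).prod halfLine) :=
    ⟨aestronglyMeasurable_gainKernel ha hb_meas f, hbound.trans_lt ENNReal.ofReal_lt_top⟩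
  have hgain : (fun x => ∫ y, gainKernel a b f (x, y) ∂halfLine) =ᵐ[weightMeasure m]
      gain a b f := by
    rw [EventuallyEq, ae_weightMeasure]
    filter_upwards [ae_restrict_mem measurableSet_Ioi] with x hx
    exact integral_gainKernel f hx
  refine ⟨⟨?_, ?_⟩, ?_⟩
  · rw [← ae_weightMeasure m]
    have hpos : ∀ᵐ x ∂weightMeasure m, 0 < x := by
      rw [ae_weightMeasure]
      exact ae_restrict_mem measurableSet_Ioi
    filter_upwards [hint.prod_right_ae, hpos] with x h1 hx
    rw [gainKernel_section, integrable_indicator_iff measurableSet_Ioi, IntegrableOn,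
      halfLine_restrict_Ioi hx] at h1
    exact h1
  · exact memLp_one_iff_integrable.2 (hint.integral_prod_left.congr hgain)
  · rw [← integral_congr_ae hgain, ← integral_prod _ hint]
    refine (le_abs_self _).trans ?_
    rw [← Real.norm_eq_abs]
    refine (norm_integral_le_lintegral_norm _).trans ?_
    refine ENNReal.toReal_le_of_le_ofReal (integral_nonneg_of_ae hD0) ?_
    simpa only [ofReal_norm] using hbound

theorem gainOp_coeFn (hf : f ∈ (gainOp m a b).domain) :
    gainOp m a b ⟨f, hf⟩ =ᵐ[weightMeasure m] gain a b f :=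
  hf.memLp.coeFn_toLp

theorem gainOp_nonneg (ha : ∀ᵐ x ∂halfLine, 0 ≤ a x) (hb : ∀ x y, 0 < x → 0 < y → 0 ≤ b x y)
    (f : (gainOp m a b).domain) (hf : 0 ≤ (f : X m)) : 0 ≤ gainOp m a b f := by
  have hf' : ∀ᵐ x ∂halfLine, 0 ≤ (f : X m) x := by
    rw [← ae_weightMeasure m]
    exact (Lp.coeFn_nonneg _).2 hf
  have h1 := gainOp_coeFn f.2
  rw [EventuallyEq, ae_weightMeasure] at h1
  rw [← Lp.coeFn_nonneg, EventuallyLE, ae_weightMeasure]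
  filter_upwards [h1, ae_restrict_mem measurableSet_Ioi] with x e1 hx
  have hx : 0 < x := hx
  refine le_of_le_of_eq ?_ e1.symm
  refine integral_nonneg_of_ae ?_
  filter_upwards [ae_Ioi_of_halfLine ha hx, ae_Ioi_of_halfLine hf' hx,
    ae_restrict_mem measurableSet_Ioi] with y h2 h3 hy
  exact mul_nonneg (mul_nonneg h2 (hb x y hx (hx.trans hy))) h3

end gainOp

end GrowthFrag

/-! ### The mass balance of the growth–fragmentation operator. -/

namespace GrowthFrag

theorem LocEssBounded.add {g k : ℝ → ℝ} (hg : LocEssBounded g) (hk : LocEssBounded k) :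
    LocEssBounded fun x => g x + k x := by
  refine ⟨hg.1.add hk.1, fun ρ => ?_⟩
  obtain ⟨M, hM⟩ := hg.2 ρ
  obtain ⟨N, hN⟩ := hk.2 ρ
  refine ⟨M + N, ?_⟩
  filter_upwards [hM, hN] with x h1 h2
  exact (abs_add_le _ _).trans (add_le_add h1 h2)

section growthFragmentation

variable {m : ℝ} {r a a₁ : ℝ → ℝ} {b : ℝ → ℝ → ℝ}

/-- The domain controls `q f`, and `0 ≤ a ≤ q`. -/
theorem memLp_fragmentation_rate_mul (ha : AEMeasurable a halfLine)
    (ha_nonneg : ∀ᵐ x ∂halfLine, 0 ≤ a x) (ha₁_nonneg : ∀ᵐ x ∂halfLine, 0 ≤ a₁ x) {f : X m}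
    (hf : f ∈ (transportOp m r fun x => a x + a₁ x).domain) :
    MemLp (fun x => a x * f x) 1 (weightMeasure m) := by
  obtain ⟨F, hF⟩ := hf
  refine hF.memLp_mul.mono ?_ ?_
  · exact (ha.mono_ac (withDensity_absolutelyContinuous _ _)).aestronglyMeasurable.mul
      (Lp.memLp f).aestronglyMeasurable
  · rw [ae_weightMeasure]
    filter_upwards [ha_nonneg, ha₁_nonneg] with x h1 h2
    rw [norm_mul, norm_mul]
    refine mul_le_mul_of_nonneg_right ?_ (norm_nonneg _)
    rw [Real.norm_of_nonneg h1, Real.norm_of_nonneg (add_nonneg h1 h2)]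
    linarith

theorem transportOp_domain_le_gainOp_domain (ha : AEMeasurable a halfLine)
    (ha_nonneg : ∀ᵐ x ∂halfLine, 0 ≤ a x) (ha₁_nonneg : ∀ᵐ x ∂halfLine, 0 ≤ a₁ x)
    (hb_meas : AEMeasurable (Function.uncurry b) (halfLine.prod halfLine))
    (hb : ∀ x y, 0 < x → 0 < y → 0 ≤ b x y) {C : ℝ} (hC : 0 ≤ C)
    (hW : ∀ᵐ y ∂halfLine, kernelWeight b m y ≤ ENNReal.ofReal (C * (1 + y ^ m))) :
    (transportOp m r fun x => a x + a₁ x).domain ≤ (gainOp m a b).domain := by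
  intro f hf
  have haf := memLp_weightMeasure_iff.1
    (memLp_fragmentation_rate_mul ha ha_nonneg ha₁_nonneg hf)
  refine (inGainDomain_of_le ha hb_meas hb (D := fun y => C * ‖(1 + y ^ m) * (a y * f y)‖)
    (haf.norm.const_mul C) (ae_of_all _ fun y => by positivity) ?_).1
  filter_upwards [hW, ae_restrict_mem measurableSet_Ioi] with y h1 hy
  have hw := (weight_pos m hy).le
  calc ‖a y * f y‖ₑ * kernelWeight b m y
      ≤ ‖a y * f y‖ₑ * ENNReal.ofReal (C * (1 + y ^ m)) := by gcongr
    _ = ENNReal.ofReal (C * ‖(1 + y ^ m) * (a y * f y)‖) := by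
      rw [← ofReal_norm, ← ENNReal.ofReal_mul (norm_nonneg _), norm_mul (1 + y ^ m),
        Real.norm_of_nonneg hw]
      congr 1
      ring

/-- The mass balance of the growth–fragmentation operator, with an amplified gain term. -/
theorem massL_transportOp_add_gainOp_le {r₀ r₁ : ℝ}
    (h : TransportCoeff r (fun x => a x + a₁ x) r₀ r₁) (hm : 1 < m) (ha : LocEssBounded a)
    (ha_nonneg : ∀ᵐ x ∂halfLine, 0 ≤ a x) (ha₁_nonneg : ∀ᵐ x ∂halfLine, 0 ≤ a₁ x)
    (hb_meas : AEMeasurable (Function.uncurry b) (halfLine.prod halfLine))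
    (hb : ∀ x y, 0 < x → 0 < y → 0 ≤ b x y) {C η ρ : ℝ} (hC : 0 ≤ C)
    (hW : ∀ᵐ y ∂halfLine, kernelWeight b m y ≤ ENNReal.ofReal (C * (1 + y ^ m)))
    (hη : 0 < η)
    (hWη : ∀ᵐ y ∂halfLine, ρ ≤ y → kernelWeight b m y ≤ ENNReal.ofReal (η * (1 + y ^ m))) :
    ∃ κ : ℝ, 0 ≤ κ ∧ ∀ (f : (transportOp m r fun x => a x + a₁ x).domain)
      (hf : (f : X m) ∈ (gainOp m a b).domain), 0 ≤ (f : X m) →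
        massL _ (transportOp m r (fun x => a x + a₁ x) f) +
            η⁻¹ * massL _ (gainOp m a b ⟨f, hf⟩) ≤
          (m * (r₀ + r₁) + κ) * massL _ (f : X m) := by
  obtain ⟨M₀, hM₀⟩ := ha.2 ρ
  -- For `ρ ≤ 0` the bound `M₀` is vacuous and may be negative.
  set M := max M₀ 0 with hM
  have hM0 : 0 ≤ M := le_max_right _ _
  have hMa : ∀ᵐ x ∂halfLine, x < ρ → a x ≤ M := by
    rw [ae_halfLine_iff]
    filter_upwards [(ae_restrict_iff' measurableSet_Ioc).1 hM₀] with x hx hx0 hxρ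
    exact (le_abs_self _).trans ((hx ⟨hx0, hxρ.le⟩).trans (le_max_left _ _))
  refine ⟨η⁻¹ * (M * C), by positivity, fun f hfB hf => ?_⟩
  obtain ⟨f, hfT⟩ := f
  have hf0 : ∀ᵐ x ∂halfLine, 0 ≤ f x := by
    rw [← ae_weightMeasure m]
    exact (Lp.coeFn_nonneg f).2 hf
  have haf := memLp_fragmentation_rate_mul ha.1 ha_nonneg ha₁_nonneg hfT
  have hafi := memLp_weightMeasure_iff.1 haf
  have hfi := memLp_weightMeasure_iff.1 (Lp.memLp f)
  -- The first term of `D` dominates the gain from `y ≥ ρ`, the second the gain from `y < ρ`, where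
  -- `a ≤ M`. After multiplication by `η⁻¹` the first becomes `∫ w a f`, which the absorption `∫ w q
  -- f` cancels.
  have hmassB := (inGainDomain_of_le (f := f) ha.1 hb_meas hb
    (D := fun y => η * ((1 + y ^ m) * (a y * f y)) + M * C * ((1 + y ^ m) * f y))
    ((hafi.const_mul η).add (hfi.const_mul (M * C))) (by
      filter_upwards [ha_nonneg, hf0, ae_restrict_mem measurableSet_Ioi] with y h1 h2 hy
      have hw := (weight_pos m hy).le
      positivity) (by
      filter_upwards [ha_nonneg, hf0, hMa, hW, hWη, ae_restrict_mem measurableSet_Ioi]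
        with y h1 h2 h3 h4 h5 hy
      have hw := (weight_pos m hy).le
      rw [← ofReal_norm, Real.norm_of_nonneg (mul_nonneg h1 h2)]
      rcases le_or_gt ρ y with hρ | hρ
      · calc _ ≤ ENNReal.ofReal (a y * f y) * ENNReal.ofReal (η * (1 + y ^ m)) := by
              gcongr
              exact h5 hρ
          _ ≤ _ := by
              rw [← ENNReal.ofReal_mul (mul_nonneg h1 h2)]
              refine ENNReal.ofReal_le_ofReal ?_
              have : 0 ≤ M * C * ((1 + y ^ m) * f y) := by positivity
              linarith
      · calc _ ≤ ENNReal.ofReal (a y * f y) * ENNReal.ofReal (C * (1 + y ^ m)) := by gcongr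
          _ ≤ _ := by
              rw [← ENNReal.ofReal_mul (mul_nonneg h1 h2)]
              refine ENNReal.ofReal_le_ofReal ?_
              have e1 : 0 ≤ η * ((1 + y ^ m) * (a y * f y)) := by positivity
              have e2 : a y * (C * ((1 + y ^ m) * f y)) ≤ M * (C * ((1 + y ^ m) * f y)) :=
                mul_le_mul_of_nonneg_right (h3 hρ) (by positivity)
              linarith)).2
  rw [integral_add (hafi.const_mul η) (hfi.const_mul (M * C)), integral_const_mul,
    integral_const_mul, ← integral_weightMeasure m (fun y => a y * f y),
    ← integral_weightMeasure m f, ← massL_apply] at hmassB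
  have hT := h.massL_transportOp_le hm ⟨f, hfT⟩ hf
  have hB : massL _ (gainOp m a b ⟨f, hfB⟩) = ∫ x, gain a b f x ∂weightMeasure m := by
    rw [massL_apply]
    exact integral_congr_ae (gainOp_coeFn hfB)
  have hq : ∫ x, a x * f x ∂weightMeasure m ≤
      ∫ x, (a x + a₁ x) * f x ∂weightMeasure m := by
    obtain ⟨F, hF⟩ := TransportCoeff.mem_domain_iff.1 hfT
    refine integral_mono_ae (memLp_one_iff_integrable.1 haf)
      (memLp_one_iff_integrable.1 hF.memLp_mul) ?_
    rw [EventuallyLE, ae_weightMeasure]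
    filter_upwards [ha₁_nonneg, hf0] with x h1 h2
    have := mul_nonneg h1 h2
    linarith
  have h1 := mul_le_mul_of_nonneg_left hmassB (inv_pos.2 hη).le
  rw [mul_add, ← mul_assoc, inv_mul_cancel₀ hη.ne', one_mul] at h1
  rw [hB]
  simp only at hT
  linarith

end growthFragmentation

end GrowthFrag

/-! ### Generation of the growth–fragmentation semigroup. -/

theorem mainTheorem2
    (a a₁ r : ℝ → ℝ) (b : ℝ → ℝ → ℝ) (r₀ r₁ b₀ l m : ℝ)
    -- the fragmentation rate
    (ha : LocEssBounded a) (ha_nonneg : ∀ᵐ x ∂halfLine, 0 ≤ a x)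
    -- the additional absorption rate; `a₁ / a` remains bounded at infinity
    (ha₁ : LocEssBounded a₁) (ha₁_nonneg : ∀ᵐ x ∂halfLine, 0 ≤ a₁ x)
    (ha₁_a : ∃ C ρ : ℝ, ∀ᵐ x ∂halfLine, ρ ≤ x → a₁ x ≤ C * a x)
    -- the growth rate
    (hr_meas : AEMeasurable r halfLine)
    (hr_int : LocallyIntegrableOn (fun x => 1 / r x) (Ioi 0))
    (hr₀ : 0 ≤ r₀) (hr₁ : 0 ≤ r₁)
    (hr : ∀ x, 0 < x → 0 < r x ∧ r x ≤ r₀ + r₁ * x)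
    -- the fragmentation kernel, with conservation of mass
    (hb_meas : AEMeasurable (Function.uncurry b) (halfLine.prod halfLine))
    (hb_nonneg : ∀ x y, 0 < x → 0 < y → 0 ≤ b x y)
    (hb_zero : ∀ x y, 0 < y → y < x → b x y = 0)
    (hb_mass : ∀ y, 0 < y → kernelMoment b 1 y = ENNReal.ofReal y)
    -- bound on the number of daughter particles
    (hb₀ : 0 < b₀) (hl : 0 ≤ l)
    (hn₀ : ∀ y, 0 < y → kernelMoment b 0 y ≤ ENNReal.ofReal (b₀ * (1 + y ^ l)))
    -- nondegeneracy of the higher moments at infinity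
    (hN : ∃ m₀ : ℝ, 1 < m₀ ∧ 0 < liminf (fun y => momentDefect b m₀ y / y ^ m₀) atTop)
    (hm : max 1 l < m) :
    (transportOp m r (fun x => a x + a₁ x)).domain ≤ (gainOp m a b).domain ∧
      ∃ 𝒮 : C0Semigroup (X m),
        𝒮.IsGenerator (transportOp m r (fun x => a x + a₁ x) + gainOp m a b) ∧
          𝒮.IsPositive := by
  obtain ⟨m₀, hm₀, hN⟩ := hN
  have hm1 : 1 < m := (le_max_left _ _).trans_lt hm
  have hlm : l < m := (le_max_right _ _).trans_lt hm
  have hT : TransportCoeff r (fun x => a x + a₁ x) r₀ r₁ :=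
    { r_meas := hr_meas
      r_int := hr_int
      r₀_nonneg := hr₀
      r₁_nonneg := hr₁
      r_bound := hr
      q_loc := ha.add ha₁
      q_nonneg := by
        filter_upwards [ha_nonneg, ha₁_nonneg] with x h1 h2 using add_nonneg h1 h2 }
  obtain ⟨hW, η, ρ, hη, hη1, hWη⟩ := exists_kernelWeight_bounds hb_meas hb_nonneg hb_mass hb₀ hl
    hn₀ hm₀ hN hm1 hlm
  have hC : 0 ≤ 2 * b₀ + 1 := by positivity
  have hdom := transportOp_domain_le_gainOp_domain (r := r) ha.1 ha_nonneg ha₁_nonneg hb_meas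
    hb_nonneg hC hW
  refine ⟨hdom, ?_⟩
  obtain ⟨κ, hκ, hmass⟩ := massL_transportOp_add_gainOp_le hT hm1 ha ha_nonneg ha₁_nonneg hb_meas
    hb_nonneg hC hW hη hWη
  have hK : 0 ≤ m * (r₀ + r₁) := mul_nonneg (by linarith) (add_nonneg hr₀ hr₁)
  -- The extra `1` meets the requirement `s ≥ m (r₀ + r₁) + 1` of `exists_solution`.
  set ω := m * (r₀ + r₁) + κ + 1 with hω
  have hres := fun (s : ℝ) (hs : ω < s) =>
    -- The choice of `ε` makes `1 + ε` equal to the amplification factor `η⁻¹`; it is positive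
    -- because `η < 1`.
    exists_resolvent_of_positive_perturbation (transportOp m r fun x => a x + a₁ x)
      (gainOp m a b) hdom (ε := η⁻¹ - 1) (by linarith [(one_lt_inv₀ hη).2 hη1]) hs
      (hT.exists_solution hm1 (by linarith)) (hT.injective (by linarith))
      (gainOp_nonneg ha_nonneg hb_nonneg) (fun f hf => by
        have h1 := hmass f (hdom f.2) hf
        have h2 : 0 ≤ massL _ (f : X m) := by
          rw [massL_of_nonneg hf]
          positivity
        rw [add_sub_cancel]
        linarith)
  choose! R hR1 hR2 hR3 hR4 using hres
  have hRes : HilleYosida.IsResolvent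
      ((transportOp m r (fun x => a x + a₁ x) + gainOp m a b).graph : Set (X m × X m)) ω R :=
    ⟨hR1, hR2, hR3⟩
  have hdense : Dense {f : X m | ∃ g, (f, g) ∈
      ((transportOp m r (fun x => a x + a₁ x) + gainOp m a b).graph : Set (X m × X m))} := by
    refine hT.dense_domain.mono fun f hf => ?_
    have hf' : f ∈ (transportOp m r (fun x => a x + a₁ x) + gainOp m a b).domain :=
      ⟨hf, hdom hf⟩
    exact ⟨_, LinearPMap.mem_graph _ ⟨f, hf'⟩⟩
  obtain ⟨𝒮, hgen, hcone⟩ := hRes.exists_semigroup hdense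
  refine ⟨𝒮, hgen, fun t f hf => ?_⟩
  exact hcone (Ici 0) isClosed_Ici (mem_Ici.2 le_rfl)
    (fun f hf g hg => mem_Ici.2 (add_nonneg (mem_Ici.1 hf) (mem_Ici.1 hg)))
    (fun c hc f hf => mem_Ici.2 (Lp_smul_nonneg hc (mem_Ici.1 hf)))
    (fun s hs f hf => mem_Ici.2 (hR4 s hs f (mem_Ici.1 hf))) t f hf
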